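/- Let $\Omega\subset\mathbb{R}^3$ be a bounded convex open set with $C^2$ boundary of positive Gaussian curvature, with unit outward normal $n(q)$ at $q\in\partial\Omega$, and put $\Gamma_-=\{(q,v)\in\partial\Omega\times\mathbb{R}^3:\ n(q)\cdot v<0\}$. For $x\in\Omega$ and $v\in\mathbb{R}^3\setminus\{0\}$ let $$\tau_-(x,v)=\inf\{t>0:\ x-tv\notin\Omega\},\qquad q_-(x,v)=x-\tau_-(x,v)v .$$ Let $0\le\gamma\le 1$ and let $B$ be a measurable collision cross-section satisfying, for some constant $C>0$, the angular cutoff assumption $0\le B(r,\theta)\le C\,r^{\gamma}\cos\theta\sin\theta$ for $r>0$, $0\le\theta\le\pi/2$. Let $$\nu(v)=\int_{\mathbb{R}^3}\int_0^{2\pi}\int_0^{\pi/2} M(v_*)\,B(|v-v_*|,\theta)\,d\theta\,d\epsilon\,dv_*,\qquad M(v)=\pi^{-3/2}e^{-|v|^2},$$ be the associated collision frequency, i.e. the function in the decomposition $L(f)=-\nu(v)f+K(f)$ of the linearized collision operator. Let $g:\Gamma_-\to\mathbb{R}$ be measurable, and suppose that there are constants $a,C>0$ such that $$|g(q_1,v)|\le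 C e^{-a|v|^2},\qquad |g(q_1,v)-g(q_2,v)|\le C|q_1-q_2|\qquad\text{for all }(q_1,v),(q_2,v)\in\Gamma_- .$$ Define $Jg(x,v)=e^{-\nu(v)\tau_-(x,v)}g(q_-(x,v),v)$ for $x\in\Omega$ and $v\neq 0$. Then, for every $0<\epsilon<1$, $Jg\in L^2_v(\mathbb{R}^3;H^{1-\epsilon}_x(\Omega))$; that is, $Jg\in L^2(\Omega\times\mathbb{R}^3)$ and $$\int_{\mathbb{R}^3}\int_\Omega\int_\Omega\frac{|Jg(x,v)-Jg(y,v)|^2}{|x-y|^{3+2(1-\epsilon)}}\,dx\,dy\,dv<\infty .$$ -/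

import Mathlib

open MeasureTheory Set Filter Topology
open scoped ENNReal Gradient RealInnerProductSpace

noncomputable section

namespace Boltzmann

/-- Three-dimensional Euclidean space, for positions and velocities. -/
abbrev E3 : Type := EuclideanSpace ℝ (Fin 3)

/-! ### Geometry of the domain -/

/-- `φ` is a `C²` defining function of the open set `Ω` near the boundary point `q`:
`Ω = {φ < 0}` near `q` and `∇φ(q) ≠ 0`, so that `∂Ω = {φ = 0}` is a regular `C²` surface
near `q`. -/
structure IsLocalDefiningFunction (Ω : Set E3) (q : E3) (φ : E3 → ℝ) : Prop where
  contDiffAt : ContDiffAt ℝ 2 φ q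
  gradient_ne_zero : ∇ φ q ≠ 0
  eventually_mem_iff : ∀ᶠ x in 𝓝 q, x ∈ Ω ↔ φ x < 0

/-- `n` is the unit outward normal of `∂Ω` at `q`, that is, `n = ∇φ(q) / |∇φ(q)|` for a local
defining function `φ` (it does not depend on the choice of `φ`). -/
def IsUnitOutwardNormal (Ω : Set E3) (q n : E3) : Prop :=
  ∃ φ : E3 → ℝ, IsLocalDefiningFunction Ω q φ ∧ n = ‖∇ φ q‖⁻¹ • ∇ φ q

/-- The second fundamental form at `q` of the surface `{φ = φ(q)}`, with respect to the unit
normal `-∇φ / |∇φ|`, evaluated at two tangent vectors: `D²φ(q)(u, w) / |∇φ(q)|`. -/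
def secondFundamentalForm (φ : E3 → ℝ) (q u w : E3) : ℝ :=
  fderiv ℝ (fderiv ℝ φ) q u w / ‖∇ φ q‖

/-- The Gaussian curvature of `∂Ω` at `q` is `κ`: the determinant of the second fundamental form
in an orthonormal basis `e₁, e₂` of the tangent plane `∇φ(q)ᗮ` (it depends neither on the basis
nor on the local defining function). -/
def HasGaussianCurvature (Ω : Set E3) (q : E3) (κ : ℝ) : Prop :=
  ∃ φ : E3 → ℝ, IsLocalDefiningFunction Ω q φ ∧
    ∃ e₁ e₂ : E3, ‖e₁‖ = 1 ∧ ‖e₂‖ = 1 ∧ ⟪e₁, e₂⟫ = 0 ∧ ⟪∇ φ q, e₁⟫ = 0 ∧ ⟪∇ φ q, e₂⟫ = 0 ∧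
      κ = secondFundamentalForm φ q e₁ e₁ * secondFundamentalForm φ q e₂ e₂
        - secondFundamentalForm φ q e₁ e₂ ^ 2

/-- A bounded convex `C²` domain of `ℝ³` whose boundary has positive Gaussian curvature. -/
structure IsPositivelyCurvedDomain (Ω : Set E3) : Prop where
  isOpen : IsOpen Ω
  isBounded : Bornology.IsBounded Ω
  convex : Convex ℝ Ω
  boundary_contDiff : ∀ q ∈ frontier Ω, ∃ φ : E3 → ℝ, IsLocalDefiningFunction Ω q φ
  curvature_pos : ∀ q ∈ frontier Ω, ∃ κ : ℝ, 0 < κ ∧ HasGaussianCurvature Ω q κ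

/-- The incoming boundary `Γ₋ = {(q, v) ∈ ∂Ω × ℝ³ : n(q) · v < 0}`. -/
def incomingBoundary (Ω : Set E3) : Set (E3 × E3) :=
  {p | p.1 ∈ frontier Ω ∧ ∃ n : E3, IsUnitOutwardNormal Ω p.1 n ∧ ⟪n, p.2⟫ < 0}

/-- The backward exit time `τ₋(x, v) = inf {t > 0 : x - t v ∉ Ω}`. For `x` in a bounded `Ω` the
set is nonempty unless `v = 0`; that value (a null set of velocities) is immaterial. -/
def exitTime (Ω : Set E3) (x v : E3) : ℝ :=
  sInf {t : ℝ | 0 < t ∧ x - t • v ∉ Ω}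

/-- The backward exit point `q₋(x, v) = x - τ₋(x, v) v`. -/
def exitPoint (Ω : Set E3) (x v : E3) : E3 :=
  x - exitTime Ω x v • v

/-! ### The collision frequency -/

/-- Grad's angular cutoff assumption with exponent `γ ∈ [0, 1]` (hard spheres, cutoff hard
potentials and cutoff Maxwellian molecules) on a cross-section `B(r, θ)`, `r = |v - v_*|`:
`0 ≤ B(r, θ) ≤ C r^γ cos θ sin θ`. -/
structure IsCutoffCrossSection (γ : ℝ) (B : ℝ → ℝ → ℝ) : Prop where
  exponent_mem : γ ∈ Icc (0 : ℝ) 1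
  measurable : Measurable (Function.uncurry B)
  bound : ∃ C : ℝ, 0 < C ∧ ∀ r θ : ℝ, 0 < r → θ ∈ Icc 0 (Real.pi / 2) →
    0 ≤ B r θ ∧ B r θ ≤ C * r ^ γ * Real.cos θ * Real.sin θ

/-- The standard Maxwellian `M(v) = π^{-3/2} e^{-|v|²}`. -/
def maxwellian (v : E3) : ℝ :=
  Real.pi ^ (-(3 / 2) : ℝ) * Real.exp (-‖v‖ ^ 2)

/-- The collision frequency
`ν(v) = ∫_{ℝ³} ∫₀^{2π} ∫₀^{π/2} M(v_*) B(|v - v_*|, θ) dθ dϵ dv_*`,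
i.e. the multiplicative part of `L(f) = M^{-1/2} (Q(M, M^{1/2} f) + Q(M^{1/2} f, M)) = -ν f + K f`,
which comes from the loss term of `Q(M^{1/2} f, M)`. -/
def collisionFrequency (B : ℝ → ℝ → ℝ) (v : E3) : ℝ :=
  ∫ w : E3, ∫ _ϵ in (0 : ℝ)..(2 * Real.pi), ∫ θ in (0 : ℝ)..(Real.pi / 2),
    maxwellian w * B ‖v - w‖ θ

/-! ### Incoming data and the function space -/

/-- The incoming data `g` is a measurable function on `Γ₋` (its values elsewhere are irrelevant)
with a Gaussian bound in `v` and a Lipschitz bound in `q`. -/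
structure IsAdmissibleIncomingData (Ω : Set E3) (g : E3 → E3 → ℝ) : Prop where
  measurable : Measurable fun p : incomingBoundary Ω => g p.1.1 p.1.2
  bounds : ∃ a C : ℝ, 0 < a ∧ 0 < C ∧
    (∀ q v : E3, (q, v) ∈ incomingBoundary Ω → |g q v| ≤ C * Real.exp (-a * ‖v‖ ^ 2)) ∧
    (∀ q₁ q₂ v : E3, (q₁, v) ∈ incomingBoundary Ω → (q₂, v) ∈ incomingBoundary Ω →
      |g q₁ v - g q₂ v| ≤ C * ‖q₁ - q₂‖)

/-- The operator `J`: `(Jg)(x, v) = e^{-ν(v) τ₋(x, v)} g(q₋(x, v), v)`. -/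
def incomingTransport (Ω : Set E3) (ν : E3 → ℝ) (g : E3 → E3 → ℝ) (x v : E3) : ℝ :=
  Real.exp (-ν v * exitTime Ω x v) * g (exitPoint Ω x v) v

/-- Membership in `L²_v(ℝ³; H^s_x(Ω))`, `0 < s < 1`: `f ∈ L²(Ω × ℝ³)` and
`∫_{ℝ³} ∫_Ω ∫_Ω |f(x, v) - f(y, v)|² / |x - y|^{3 + 2s} dx dy dv < ∞`. -/
def MemL2Hs (s : ℝ) (Ω : Set E3) (f : E3 → E3 → ℝ) : Prop :=
  MemLp (Function.uncurry f) 2 ((volume.restrict Ω).prod volume) ∧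
    ∫⁻ v : E3, ∫⁻ y in Ω, ∫⁻ x in Ω,
      ENNReal.ofReal (|f x v - f y v| ^ 2 / ‖x - y‖ ^ (3 + 2 * s)) < ∞

end Boltzmann

end

noncomputable section

namespace Boltzmann

/-! Positive curvature and compactness give one `R` such that every boundary point `a` has a unit
vector `n` with `‖b - a‖² ≤ R ⟪n, a - b⟫` on `Ω` (`exists_isEnclosedAt`). This controls grazing
trajectories. Let `a` be the exit point of `x`, `N = -⟪n, v⟫`, `τ` the exit time and `d` the
distance of `x` to the complement. Then `d ≤ τ N` and `τ ‖v‖² ≤ R N`, so `N ≥ ‖v‖ √(d / R)`. The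
exit point of `y` lies on the inner side of the plane through `a` normal to `n`, hence `(τ_y - τ_x)
N ≤ ‖x - y‖`. By symmetry `|τ_x - τ_y| ‖v‖ ≤ √R ‖x - y‖ (d_x^{-1/2} + d_y^{-1/2})`, and the exit
points obey a similar bound.

Since `ν(v)` grows at most linearly, `Jg(·, v)` satisfies a weighted Lipschitz bound with factor `K
(1 + 1/‖v‖)` (`exists_abs_incomingTransport_sub_le`). Its square would give the non-integrable
weights `d⁻¹` and `‖x - y‖⁻³`, and no decay in `v`. Interpolating as `Δ² ≤ (Gaussian bound)^ε
(Lipschitz bound)^(2-ε)` repairs all three: what remains is `d^{-(1-ε/2)}`, integrable because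
boundary layers have volume linear in their width; `‖x - y‖^{-(3-ε)}`, integrable in dimension
three; and `e^{-aε‖v‖²} (1 + 1/‖v‖)²`. -/

/-- Second order Taylor expansion, uniform in the base point, with the Hessian frozen at `q`. -/
lemma _root_.ContDiffAt.exists_taylor_two_bound {E : Type*} [NormedAddCommGroup E]
    [NormedSpace ℝ E] {φ : E → ℝ} {q : E} (h : ContDiffAt ℝ 2 φ q) {η : ℝ} (hη : 0 < η) :
    ∃ r > 0, ∀ a ∈ Metric.ball q r, ∀ b ∈ Metric.ball q r,
      |φ b - φ a - fderiv ℝ φ a (b - a) - 2⁻¹ * fderiv ℝ (fderiv ℝ φ) q (b - a) (b - a)|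
        ≤ η * ‖b - a‖ ^ 2 := by
  set H := fderiv ℝ (fderiv ℝ φ) q with hH
  have hsymm : IsSymmSndFDerivAt ℝ φ q := h.isSymmSndFDerivAt (by simp)
  have hdiff : ∀ᶠ x in 𝓝 q, DifferentiableAt ℝ φ x :=
    (h.eventually (by simp)).mono fun x hx => hx.differentiableAt (by simp)
  have hstrict : HasStrictFDerivAt (fderiv ℝ φ) H q :=
    (h.fderiv_right (m := 1) (by norm_num)).hasStrictFDerivAt (by simp)
  have hlo := (hstrict.isLittleO.def hη)
  rw [nhds_prod_eq] at hlo
  obtain ⟨t, ht, hlo⟩ := Filter.eventually_prod_self_iff'.1 hlo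
  obtain ⟨r, hr, hball⟩ := Metric.mem_nhds_iff.1 (Filter.inter_mem ht hdiff)
  refine ⟨r, hr, fun a ha b hb => ?_⟩
  -- The mean value inequality is applied on a convex set containing `a` and `b` whose points are no
  -- farther from `a` than `b` is. Symmetry of the second derivative makes the derivative of the
  -- remainder exactly the quantity controlled by strict differentiability of `fderiv ℝ φ` at `q`.
  set s := Metric.ball q r ∩ Metric.closedBall a ‖b - a‖
  have hs : Convex ℝ s := (convex_ball _ _).inter (convex_closedBall _ _)
  have hderiv : ∀ z ∈ s, HasFDerivWithinAt
      (fun z => φ z - fderiv ℝ φ a (z - a) - 2⁻¹ * H (z - a) (z - a))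
      (fderiv ℝ φ z - fderiv ℝ φ a - H (z - a)) s z := by
    intro z hz
    have h1 : HasFDerivAt φ (fderiv ℝ φ z) z := (hball hz.1).2.hasFDerivAt
    have h0 : HasFDerivAt (fun z : E => z - a) (ContinuousLinearMap.id ℝ E) z :=
      (hasFDerivAt_id z).sub_const a
    have h2 := (fderiv ℝ φ a).hasFDerivAt.comp z h0
    have h3 := ((H.hasFDerivAt.comp z h0).clm_apply h0).const_mul (2⁻¹ : ℝ)
    refine (((h1.sub h2).sub h3).congr_fderiv ?_).hasFDerivWithinAt
    ext w
    have := hsymm.eq w (z - a)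
    simp only [Function.comp, sub_apply, smul_apply,
      add_apply, ContinuousLinearMap.comp_apply,
      ContinuousLinearMap.flip_apply, smul_eq_mul, ContinuousLinearMap.id_apply] at this ⊢
    rw [← hH] at this
    rw [this]
    ring
  have hbound : ∀ z ∈ s, ‖fderiv ℝ φ z - fderiv ℝ φ a - H (z - a)‖ ≤ η * ‖b - a‖ := by
    intro z hz
    refine (hlo z (hball hz.1).1 a (hball ha).1).trans ?_
    dsimp only
    have := mem_closedBall_iff_norm.1 hz.2
    gcongr
  have hmv := hs.norm_image_sub_le_of_norm_hasFDerivWithin_le hderiv hbound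
    (x := a) (y := b) ⟨ha, by simp⟩ ⟨hb, mem_closedBall_iff_norm.2 le_rfl⟩
  simp only [sub_self, map_zero, mul_zero, sub_zero,
    Real.norm_eq_abs] at hmv
  refine le_trans (le_of_eq ?_) (hmv.trans (le_of_eq (by ring)))
  congr 1
  ring

/-- A quadratic form that is positive on the kernel of a linear form becomes positive definite
after adding a large multiple of the square of the linear form. -/
lemma exists_coercive_of_pos_on_ker {E : Type*} [NormedAddCommGroup E] [NormedSpace ℝ E]
    [FiniteDimensional ℝ E] (H : E →L[ℝ] E →L[ℝ] ℝ) (ℓ : E →L[ℝ] ℝ)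
    (hpos : ∀ w, ℓ w = 0 → w ≠ 0 → 0 < H w w) :
    ∃ c > 0, ∃ Λ : ℝ, 0 ≤ Λ ∧ ∀ w, c * ‖w‖ ^ 2 ≤ H w w + Λ * ℓ w ^ 2 := by
  have hcont : ∀ n : ℝ, Continuous fun w => H w w + n * ℓ w ^ 2 := fun n =>
    ((H.continuous.clm_apply continuous_id)).add (continuous_const.mul (ℓ.continuous.pow 2))
  have hK : IsCompact (Metric.sphere (0 : E) 1) := isCompact_sphere _ _
  -- These open sets increase with `n` and cover the unit sphere, so by compactness a single `n`
  -- suffices; homogeneity then extends the bound to all `w`.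
  obtain ⟨n, hn⟩ := hK.elim_directed_cover (fun n : ℕ => {w : E | 0 < H w w + n * ℓ w ^ 2})
    (fun n => isOpen_lt continuous_const (hcont n)) (by
      intro w hw
      have hw0 : w ≠ 0 := by rintro rfl; simp at hw
      rw [mem_iUnion]
      by_cases hl : ℓ w = 0
      · exact ⟨0, by simpa using hpos w hl hw0⟩
      · have h2 : 0 < ℓ w ^ 2 := by positivity
        obtain ⟨n, hn⟩ := exists_nat_gt (-(H w w) / ℓ w ^ 2)
        refine ⟨n, ?_⟩
        rw [div_lt_iff₀ h2] at hn
        simp only [mem_ofPred_eq]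
        linarith)
    (directed_of_isDirected_le fun i j hij w hw => by
      have hij' : (i : ℝ) ≤ j := by exact_mod_cast hij
      simp only [mem_ofPred_eq] at hw ⊢
      nlinarith [sq_nonneg (ℓ w)])
  obtain ⟨c, hc, hcw⟩ := hK.exists_forall_le' (hcont n).continuousOn (a := 0) (fun w hw => hn hw)
  refine ⟨c, hc, n, by positivity, fun w => ?_⟩
  rcases eq_or_ne w 0 with rfl | hw
  · simp
  · have hw' : 0 < ‖w‖ := norm_pos_iff.2 hw
    have := hcw (‖w‖⁻¹ • w) (by simp [norm_smul, hw'.ne'])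
    simp only [map_smul, smul_apply, smul_eq_mul] at this
    have h2 := mul_le_mul_of_nonneg_right this (sq_nonneg ‖w‖)
    refine h2.trans (le_of_eq ?_)
    field_simp

/-! ### Convexity and curvature in terms of a defining function. -/

section LocalDefiningFunction

variable {Ω : Set E3} {q : E3} {φ : E3 → ℝ}

lemma IsLocalDefiningFunction.apply_eq_zero (h : IsLocalDefiningFunction Ω q φ)
    (ho : IsOpen Ω) (hq : q ∈ frontier Ω) : φ q = 0 := by
  refine le_antisymm ?_ ?_
  · have hfr : ∃ᶠ x in 𝓝 q, x ∈ Ω := mem_closure_iff_frequently.1 hq.1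
    by_contra! hlt
    have h1 := h.contDiffAt.continuousAt.eventually (lt_mem_nhds hlt)
    obtain ⟨x, hx, hx1, hx2⟩ := (hfr.and_eventually (h.eventually_mem_iff.and h1)).exists
    exact lt_asymm (hx1.1 hx) hx2
  · by_contra! hlt
    have := h.eventually_mem_iff.self_of_nhds.2 hlt
    rw [ho.frontier_eq] at hq
    exact hq.2 this

lemma add_smul_sub_mem (ho : IsOpen Ω) (hc : Convex ℝ Ω) {x : E3} (hx : x ∈ Ω)
    (hq : q ∈ closure Ω) {t : ℝ} (ht : t ∈ Ioc (0 : ℝ) 1) : q + t • (x - q) ∈ Ω := by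
  rw [← ho.interior_eq] at hx ⊢
  exact hc.add_smul_sub_mem_interior' hq hx ht

/-- The segment from `q` to `x` stays in `Ω`, where `φ < 0 = φ q`, so the derivative along it is
nonpositive. Equality is impossible because `Ω` is open: moving `x` slightly along `∇ φ q` would
make the product positive. -/
lemma IsLocalDefiningFunction.inner_gradient_neg (h : IsLocalDefiningFunction Ω q φ)
    (ho : IsOpen Ω) (hc : Convex ℝ Ω) (hq : q ∈ frontier Ω) {x : E3} (hx : x ∈ Ω) :
    ⟪∇ φ q, x - q⟫ < 0 := by
  have hle : ∀ x ∈ Ω, ⟪∇ φ q, x - q⟫ ≤ 0 := by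
    intro x hx
    rw [inner_gradient_left]
    have hd : HasFDerivAt φ (fderiv ℝ φ q) q :=
      (h.contDiffAt.differentiableAt (by simp)).hasFDerivAt
    have hline := (hd.hasLineDerivAt (x - q)).hasDerivWithinAt (s := Ioi 0)
    rw [hasDerivWithinAt_iff_tendsto_slope' (by simp)] at hline
    refine le_of_tendsto hline ?_
    have hcont : Tendsto (fun t : ℝ => q + t • (x - q)) (𝓝[>] 0) (𝓝 q) := by
      refine Tendsto.mono_left ?_ nhdsWithin_le_nhds
      have : Continuous fun t : ℝ => q + t • (x - q) := by fun_prop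
      simpa using this.tendsto 0
    filter_upwards [hcont.eventually h.eventually_mem_iff,
      Ioc_mem_nhdsGT (zero_lt_one (α := ℝ))] with t ht ht1
    have hneg := ht.1 (add_smul_sub_mem ho hc hx hq.1 ht1)
    simp only [slope, vsub_eq_sub, zero_smul, add_zero, h.apply_eq_zero ho hq, sub_zero,
      smul_eq_mul]
    have : 0 < t⁻¹ := inv_pos.2 ht1.1
    nlinarith
  have hcont : Tendsto (fun t : ℝ => x + t • ∇ φ q) (𝓝[>] 0) (𝓝 x) := by
    refine Tendsto.mono_left ?_ nhdsWithin_le_nhds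
    have : Continuous fun t : ℝ => x + t • ∇ φ q := by fun_prop
    simpa using this.tendsto 0
  obtain ⟨t, ht, ht0⟩ := ((hcont.eventually (ho.mem_nhds hx)).and self_mem_nhdsWithin).exists
  have := hle _ ht
  rw [add_sub_right_comm, inner_add_right, inner_smul_right, real_inner_self_eq_norm_sq] at this
  have hg : 0 < ‖∇ φ q‖ := norm_pos_iff.2 h.gradient_ne_zero
  have ht0 : 0 < t := ht0
  nlinarith [mul_pos ht0 (pow_pos hg 2)]

/-- The Hessian of a defining function of a convex set is nonnegative on the tangent plane. -/
lemma IsLocalDefiningFunction.hessian_nonneg (h : IsLocalDefiningFunction Ω q φ)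
    (ho : IsOpen Ω) (hc : Convex ℝ Ω) (hq : q ∈ frontier Ω) {u : E3} (hu : ⟪∇ φ q, u⟫ = 0) :
    0 ≤ fderiv ℝ (fderiv ℝ φ) q u u := by
  by_contra! hlt
  have hu0 : u ≠ 0 := by rintro rfl; simp at hlt
  have hun : 0 < ‖u‖ := norm_pos_iff.2 hu0
  set H := fderiv ℝ (fderiv ℝ φ) q
  -- With this `η` the Taylor error is at most half of the negative quadratic term, so `φ < 0` at `q
  -- + t • u`. That point would lie in `Ω`, although tangent directions never enter `Ω`.
  obtain ⟨r, hr, hT⟩ := h.contDiffAt.exists_taylor_two_bound (η := -(H u u) / (4 * ‖u‖ ^ 2))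
    (div_pos (by linarith) (by positivity))
  have hcont : Tendsto (fun t : ℝ => q + t • u) (𝓝[>] 0) (𝓝 q) := by
    refine Tendsto.mono_left ?_ nhdsWithin_le_nhds
    have : Continuous fun t : ℝ => q + t • u := by fun_prop
    simpa using this.tendsto 0
  obtain ⟨t, ⟨ht1, ht2⟩, ht0⟩ := ((hcont.eventually (h.eventually_mem_iff.and
    (Metric.ball_mem_nhds q hr))).and self_mem_nhdsWithin).exists
  have ht0 : 0 < t := ht0
  have h3 := hT q (Metric.mem_ball_self hr) _ ht2
  have hnot : q + t • u ∉ Ω := fun hmem => by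
    have := h.inner_gradient_neg ho hc hq hmem
    simp [inner_smul_right, hu] at this
  have hφ : 0 ≤ φ (q + t • u) := by
    by_contra! hφ
    exact hnot (ht1.2 hφ)
  rw [h.apply_eq_zero ho hq, add_sub_cancel_left, ← inner_gradient_left, inner_smul_right, hu,
    norm_smul, Real.norm_eq_abs, mul_pow, sq_abs] at h3
  simp only [map_smul, smul_apply, smul_eq_mul] at h3
  have h4 := (abs_le.1 h3).2
  have h5 : -(H u u) / (4 * ‖u‖ ^ 2) * (t ^ 2 * ‖u‖ ^ 2) = -(H u u) * t ^ 2 / 4 := by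
    field_simp
  rw [h5] at h4
  nlinarith [mul_pos ht0 ht0, mul_pos (mul_pos ht0 ht0) (neg_pos.2 hlt)]

/-- A nonzero residual would be a fourth nonzero vector orthogonal to `g`, `e₁`, `e₂` in dimension
three. -/
lemma eq_add_of_orthonormal_of_orthogonal {g e₁ e₂ w : E3} (hg : g ≠ 0) (h₁ : ‖e₁‖ = 1)
    (h₂ : ‖e₂‖ = 1) (h₁₂ : ⟪e₁, e₂⟫ = 0) (hg₁ : ⟪g, e₁⟫ = 0) (hg₂ : ⟪g, e₂⟫ = 0)
    (hw : ⟪g, w⟫ = 0) : w = ⟪e₁, w⟫ • e₁ + ⟪e₂, w⟫ • e₂ := by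
  by_contra hne
  set r := w - (⟪e₁, w⟫ • e₁ + ⟪e₂, w⟫ • e₂) with hr
  have hr0 : r ≠ 0 := sub_ne_zero.2 hne
  have he₁ : e₁ ≠ 0 := by rintro rfl; simp at h₁
  have he₂ : e₂ ≠ 0 := by rintro rfl; simp at h₂
  have h₂₁ : ⟪e₂, e₁⟫ = 0 := by rw [real_inner_comm, h₁₂]
  have a1 : ⟪g, r⟫ = 0 := by
    simp [hr, inner_sub_right, inner_add_right, inner_smul_right, hg₁, hg₂, hw]
  have a2 : ⟪e₁, r⟫ = 0 := by
    simp [hr, inner_sub_right, inner_add_right, inner_smul_right, h₁₂, h₁]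
  have a3 : ⟪e₂, r⟫ = 0 := by
    simp [hr, inner_sub_right, inner_add_right, inner_smul_right, h₂₁, h₂]
  have hli : LinearIndependent ℝ ![g, e₁, e₂, r] := by
    refine linearIndependent_of_ne_zero_of_inner_eq_zero (𝕜 := ℝ) ?_ ?_
    · intro i; fin_cases i <;> simp [hg, he₁, he₂, hr0]
    · intro i j hij
      have c1 := real_inner_comm e₁ g
      have c2 := real_inner_comm e₂ g
      have c3 := real_inner_comm r g
      have c4 := real_inner_comm r e₁
      have c5 := real_inner_comm r e₂
      fin_cases i <;> fin_cases j <;> simp_all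
  have := hli.fintype_card_le_finrank
  simp at this

/-- Positive Gaussian curvature and convexity make the Hessian of a defining function positive
definite on the tangent plane. -/
lemma HasGaussianCurvature.exists_hessian_pos {κ : ℝ} (h : HasGaussianCurvature Ω q κ)
    (hκ : 0 < κ) (ho : IsOpen Ω) (hc : Convex ℝ Ω) (hq : q ∈ frontier Ω) :
    ∃ φ : E3 → ℝ, IsLocalDefiningFunction Ω q φ ∧
      ∀ w, fderiv ℝ φ q w = 0 → w ≠ 0 → 0 < fderiv ℝ (fderiv ℝ φ) q w w := by
  obtain ⟨φ, hφ, e₁, e₂, h₁, h₂, h₁₂, hg₁, hg₂, rfl⟩ := h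
  refine ⟨φ, hφ, fun w hw hw0 => ?_⟩
  rw [← inner_gradient_left] at hw
  have hdec := eq_add_of_orthonormal_of_orthogonal hφ.gradient_ne_zero h₁ h₂ h₁₂ hg₁ hg₂ hw
  set x := ⟪e₁, w⟫
  set y := ⟪e₂, w⟫
  have hsymm : IsSymmSndFDerivAt ℝ φ q := hφ.contDiffAt.isSymmSndFDerivAt (by simp)
  have hs := hsymm.eq e₁ e₂
  have hpos₁ := hφ.hessian_nonneg ho hc hq hg₁
  simp only [secondFundamentalForm] at hκ
  have hgn : 0 < ‖∇ φ q‖ := norm_pos_iff.2 hφ.gradient_ne_zero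
  set H := fderiv ℝ (fderiv ℝ φ) q
  have hdet : 0 < H e₁ e₁ * H e₂ e₂ - H e₁ e₂ ^ 2 := by
    have := mul_pos hκ (pow_pos hgn 2)
    field_simp at this
    linarith
  have hpos : 0 < H e₁ e₁ := by
    rcases hpos₁.lt_or_eq with h | h
    · exact h
    · rw [← h] at hdet; nlinarith [sq_nonneg (H e₁ e₂)]
  have hww : H w w = x ^ 2 * H e₁ e₁ + 2 * x * y * H e₁ e₂ + y ^ 2 * H e₂ e₂ := by
    rw [hdec]
    simp only [map_add, map_smul, add_apply, smul_apply,
      smul_eq_mul, ← hs]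
    ring
  have hxy : ¬ (x = 0 ∧ y = 0) := by
    rintro ⟨hx, hy⟩
    rw [hx, hy] at hdec
    exact hw0 (by simpa using hdec)
  -- Completing the square. `H e₁ e₁ > 0` comes from convexity, since the value `0` would make the
  -- determinant nonpositive.
  have key : H e₁ e₁ * H w w
      = (x * H e₁ e₁ + y * H e₁ e₂) ^ 2 + y ^ 2 * (H e₁ e₁ * H e₂ e₂ - H e₁ e₂ ^ 2) := by
    rw [hww]; ring
  refine pos_of_mul_pos_right (a := H e₁ e₁) ?_ hpos.le
  rw [key]
  by_cases hy : y = 0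
  · have hx : x ≠ 0 := fun hx => hxy ⟨hx, hy⟩
    rw [hy]
    have := mul_ne_zero hx hpos.ne'
    have := sq_pos_of_ne_zero this
    simpa
  · have := sq_pos_of_ne_zero hy
    positivity

end LocalDefiningFunction

/-! ### Uniform convexity: enclosing balls. -/

section UniformConvexity

variable {Ω : Set E3} {q : E3} {φ : E3 → ℝ}

lemma IsLocalDefiningFunction.continuousAt_fderiv (h : IsLocalDefiningFunction Ω q φ) :
    ContinuousAt (fderiv ℝ φ) q :=
  (h.contDiffAt.fderiv_right (m := 1) (by norm_num)).continuousAt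

lemma IsLocalDefiningFunction.eventually (h : IsLocalDefiningFunction Ω q φ) :
    ∀ᶠ a in 𝓝 q, IsLocalDefiningFunction Ω a φ := by
  have h1 : ∀ᶠ a in 𝓝 q, fderiv ℝ φ a ≠ 0 := by
    refine h.continuousAt_fderiv.eventually_ne fun h0 => h.gradient_ne_zero ?_
    simp [gradient, h0]
  filter_upwards [h.contDiffAt.eventually (by simp), h1,
    eventually_eventually_nhds.2 h.eventually_mem_iff] with a ha1 ha2 ha3
  refine ⟨ha1, fun h0 => ha2 ?_, ha3⟩
  rw [← toDual_gradient, h0, map_zero]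

lemma norm_gradient (φ : E3 → ℝ) (a : E3) : ‖∇ φ a‖ = ‖fderiv ℝ φ a‖ := by
  rw [← toDual_gradient, LinearIsometryEquiv.norm_map]

/-- `Ω` lies in the ball of diameter `R` that touches the plane `a + nᗮ` at `a` from the side
of `-n`. -/
def IsEnclosedAt (Ω : Set E3) (R : ℝ) (a n : E3) : Prop :=
  ‖n‖ = 1 ∧ ∀ b ∈ Ω, ‖b - a‖ ^ 2 ≤ R * ⟪n, a - b⟫

lemma IsEnclosedAt.mono {R R' : ℝ} {a n : E3} (h : IsEnclosedAt Ω R a n) (hR : 0 < R)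
    (hRR' : R ≤ R') : IsEnclosedAt Ω R' a n := by
  refine ⟨h.1, fun b hb => (h.2 b hb).trans ?_⟩
  have : 0 ≤ ⟪n, a - b⟫ := by
    by_contra! hlt
    nlinarith [h.2 b hb, sq_nonneg ‖b - a‖]
  gcongr

/-- Expand `φ` at `a`: since `φ b < 0 = φ a`, half the Hessian at `w = b - a` is at most `s =
-dφ_a(w)` plus a small error. Coercivity of the Hessian at `q`, corrected by `Λ (dφ_q w)²`, bounds
it below, and `dφ_q w` is close to `-s`. The vector `n` is the normalized gradient at `a`. -/
lemma IsLocalDefiningFunction.exists_local_quadratic_lower_bound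
    (h : IsLocalDefiningFunction Ω q φ) (ho : IsOpen Ω) (hc : Convex ℝ Ω)
    (hpos : ∀ w, fderiv ℝ φ q w = 0 → w ≠ 0 → 0 < fderiv ℝ (fderiv ℝ φ) q w w) :
    ∃ r > 0, ∃ R > 0, ∀ a ∈ frontier Ω, a ∈ Metric.ball q r → ∃ n : E3, ‖n‖ = 1 ∧
      ∀ b ∈ Ω, b ∈ Metric.ball q r → ‖b - a‖ ^ 2 ≤ R * ⟪n, a - b⟫ := by
  obtain ⟨c, hc0, Λ, hΛ, hcoer⟩ := exists_coercive_of_pos_on_ker _ _ hpos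
  obtain ⟨r₀, hr₀, hT⟩ := h.contDiffAt.exists_taylor_two_bound (η := c / 8) (by positivity)
  -- Tolerance for `dφ_a - dφ_q`: as `κ ≤ 1`, `Λ κ² ≤ Λ κ ≤ c / 8`, and the gradients at `a` are
  -- bounded by `G`.
  set κ := min 1 (c / (8 * (Λ + 1)))
  have hκ : 0 < κ := by positivity
  have hκ1 : κ ≤ 1 := min_le_left _ _
  have hκ2 : Λ * κ ^ 2 ≤ c / 8 := by
    have h1 : κ ≤ c / (8 * (Λ + 1)) := min_le_right _ _
    rw [le_div_iff₀ (by positivity)] at h1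
    nlinarith [mul_nonneg hΛ hκ.le]
  obtain ⟨r, hr, hball⟩ := Metric.mem_nhds_iff.1 (Filter.inter_mem (Metric.ball_mem_nhds q hr₀)
    (Filter.inter_mem h.eventually
      (h.continuousAt_fderiv.eventually (Metric.closedBall_mem_nhds _ hκ))))
  set G := ‖fderiv ℝ φ q‖ + 1
  have hG : 0 < G := by positivity
  refine ⟨r, hr, 4 * (1 + Λ * (G * (2 * r))) * G / c, by positivity, fun a ha har => ?_⟩
  obtain ⟨har₀, hφa, hκa⟩ := hball har
  have hκa : ‖fderiv ℝ φ a - fderiv ℝ φ q‖ ≤ κ := mem_closedBall_iff_norm.1 hκa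
  have hga : 0 < ‖∇ φ a‖ := norm_pos_iff.2 hφa.gradient_ne_zero
  have hgG : ‖∇ φ a‖ ≤ G := by
    rw [norm_gradient]
    have := norm_le_norm_add_norm_sub' (fderiv ℝ φ a) (fderiv ℝ φ q)
    linarith
  refine ⟨‖∇ φ a‖⁻¹ • ∇ φ a, by simp [norm_smul, hga.ne'], fun b hb hbr => ?_⟩
  obtain ⟨hbr₀, -, -⟩ := hball hbr
  set w := b - a
  have hw : ‖w‖ ≤ 2 * r := by
    have h1 := mem_ball_iff_norm.1 har
    have h2 := mem_ball_iff_norm.1 hbr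
    have : w = (b - q) - (a - q) := by simp [w]
    rw [this]
    exact (norm_sub_le _ _).trans (by linarith)
  set s := -fderiv ℝ φ a w with hs
  have hs0 : 0 < s := by
    rw [hs, ← inner_gradient_left]
    exact neg_pos.2 (hφa.inner_gradient_neg ho hc ha hb)
  have hsG : s ≤ G * (2 * r) := by
    have h1 : s ≤ ‖fderiv ℝ φ a‖ * ‖w‖ :=
      (neg_le_abs _).trans ((fderiv ℝ φ a).le_opNorm w)
    rw [← norm_gradient] at h1
    exact h1.trans (by gcongr)
  have hℓ : fderiv ℝ φ q w ^ 2 ≤ 2 * s ^ 2 + 2 * κ ^ 2 * ‖w‖ ^ 2 := by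
    have h1 : |(fderiv ℝ φ a - fderiv ℝ φ q) w| ≤ κ * ‖w‖ :=
      ((fderiv ℝ φ a - fderiv ℝ φ q).le_opNorm w).trans (by gcongr)
    have h2 := sq_le_sq' (neg_le_of_abs_le h1) (le_of_abs_le h1)
    rw [sub_apply] at h2
    have h3 : fderiv ℝ φ a w = -s := by simp [hs]
    rw [h3] at h2
    nlinarith [sq_nonneg (s - (s + fderiv ℝ φ q w)), sq_nonneg (fderiv ℝ φ q w + 2 * s)]
  have hTb := (abs_le.1 (hT a har₀ b hbr₀)).1
  have hφb : φ b < 0 := by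
    have := (hball hbr).2.1.eventually_mem_iff.self_of_nhds
    exact this.1 hb
  rw [hφa.apply_eq_zero ho ha] at hTb
  have hco := hcoer w
  have h1 : Λ * fderiv ℝ φ q w ^ 2 ≤ Λ * (2 * s ^ 2 + 2 * κ ^ 2 * ‖w‖ ^ 2) := by gcongr
  have h2 : Λ * κ ^ 2 * ‖w‖ ^ 2 ≤ c / 8 * ‖w‖ ^ 2 := by gcongr
  have h3 : Λ * s ^ 2 ≤ Λ * (G * (2 * r)) * s := by
    have := mul_le_mul_of_nonneg_left hsG hs0.le
    nlinarith
  -- Of the `c / 2` from coercivity, `c / 8` pays for the Taylor error and `c / 8` for the tilt of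
  -- the differential.
  have h4 : c / 4 * ‖w‖ ^ 2 ≤ (1 + Λ * (G * (2 * r))) * s := by
    change _ ≤ φ b - 0 - fderiv ℝ φ a w - _ at hTb
    have h3' : fderiv ℝ φ a w = -s := by simp [hs]
    rw [h3'] at hTb
    nlinarith
  have h5 : ⟪‖∇ φ a‖⁻¹ • ∇ φ a, a - b⟫ = s / ‖∇ φ a‖ := by
    rw [real_inner_smul_left, inner_gradient_left, ← neg_sub b a, map_neg]
    field_simp
    rw [hs]
  have h6 : s / G ≤ s / ‖∇ φ a‖ := by gcongr
  rw [h5]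
  calc ‖w‖ ^ 2 = 4 / c * (c / 4 * ‖w‖ ^ 2) := by field_simp
    _ ≤ 4 / c * ((1 + Λ * (G * (2 * r))) * s) := by gcongr
    _ = 4 * (1 + Λ * (G * (2 * r))) * G / c * (s / G) := by field_simp
    _ ≤ _ := by gcongr

/-- A positively curved domain is uniformly convex: one radius serves for enclosing balls at all
boundary points. -/
lemma IsPositivelyCurvedDomain.exists_isEnclosedAt (h : IsPositivelyCurvedDomain Ω) :
    ∃ R > 0, ∀ a ∈ frontier Ω, ∃ n, IsEnclosedAt Ω R a n := by
  have hK : IsCompact (frontier Ω) :=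
    Metric.isCompact_of_isClosed_isBounded isClosed_frontier
      (h.isBounded.closure.subset frontier_subset_closure)
  -- The doubled membership lets the compactness induction run over sets that are not contained in
  -- the frontier.
  suffices ∃ R > 0, ∀ a ∈ frontier Ω, a ∈ frontier Ω → ∃ n, IsEnclosedAt Ω R a n by
    simpa using this
  refine hK.induction_on (p := fun s => ∃ R > 0, ∀ a ∈ s, a ∈ frontier Ω →
    ∃ n, IsEnclosedAt Ω R a n) ⟨1, one_pos, by simp⟩ ?_ ?_ ?_
  · rintro s t hst ⟨R, hR, H⟩
    exact ⟨R, hR, fun a ha => H a (hst ha)⟩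
  · rintro s t ⟨R, hR, H⟩ ⟨R', hR', H'⟩
    refine ⟨max R R', by positivity, fun a ha haΩ => ?_⟩
    rcases ha with ha | ha
    · obtain ⟨n, hn⟩ := H a ha haΩ
      exact ⟨n, hn.mono hR (le_max_left _ _)⟩
    · obtain ⟨n, hn⟩ := H' a ha haΩ
      exact ⟨n, hn.mono hR' (le_max_right _ _)⟩
  · intro q hq
    obtain ⟨κ, hκ, hcurv⟩ := h.curvature_pos q hq
    obtain ⟨φ, hφ, hpos⟩ := hcurv.exists_hessian_pos hκ h.isOpen h.convex hq
    obtain ⟨r, hr, R, hR, H⟩ := hφ.exists_local_quadratic_lower_bound h.isOpen h.convex hpos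
    -- Passage from local to global: for any `b ∈ Ω`, the point `a + t • (b - a)` is in `Ω` by
    -- convexity and within the local radius because `t * D ≤ r / 2`. The local bound there scales
    -- back to `b` with `R / t`.
    set D := Metric.diam (closure Ω) + 1
    have hD : 0 < D := by positivity
    set t := min 1 (r / (2 * D))
    have ht : 0 < t := by positivity
    have ht1 : t ≤ 1 := min_le_left _ _
    have htD : t * D ≤ r / 2 := by
      have h1 : t ≤ r / (2 * D) := min_le_right _ _
      rw [le_div_iff₀ (by positivity)] at h1
      linarith
    refine ⟨Metric.ball q (r / 2), mem_nhdsWithin_of_mem_nhds (Metric.ball_mem_nhds q (by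
      positivity)), R / t, by positivity, fun a har ha => ?_⟩
    obtain ⟨n, hn, Hn⟩ := H a ha (Metric.ball_subset_ball (by linarith) har)
    refine ⟨n, hn, fun b hb => ?_⟩
    have hba : ‖b - a‖ ≤ D := by
      rw [← dist_eq_norm]
      exact (Metric.dist_le_diam_of_mem h.isBounded.closure (subset_closure hb) ha.1).trans
        (by simp [D])
    have h1 := Hn _ (add_smul_sub_mem h.isOpen h.convex hb ha.1 ⟨ht, ht1⟩) (by
      have h2 := mem_ball_iff_norm.1 har
      rw [mem_ball_iff_norm, add_sub_right_comm]
      refine (norm_add_le _ _).trans_lt ?_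
      rw [norm_smul, Real.norm_of_nonneg ht.le]
      have : t * ‖b - a‖ ≤ t * D := by gcongr
      linarith)
    rw [add_sub_cancel_left, norm_smul, Real.norm_of_nonneg ht.le, sub_add_cancel_left,
      ← smul_neg, neg_sub, real_inner_smul_right, mul_pow] at h1
    rw [div_mul_eq_mul_div, le_div_iff₀ ht]
    refine le_of_mul_le_mul_right ?_ ht
    linarith

end UniformConvexity

/-! ### Exit times and exit points. -/

section ExitTime

variable {Ω : Set E3} {x y v : E3}

lemma exists_pos_sub_smul_notMem (hb : Bornology.IsBounded Ω) (x : E3) (hv : v ≠ 0) :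
    ∃ t : ℝ, 0 < t ∧ x - t • v ∉ Ω := by
  obtain ⟨C, hC⟩ := hb.exists_norm_le
  have hv' : 0 < ‖v‖ := norm_pos_iff.2 hv
  refine ⟨(|C| + ‖x‖ + 1) / ‖v‖, by positivity, fun hmem => ?_⟩
  have h1 := hC _ hmem
  have h2 := norm_sub_norm_le (((|C| + ‖x‖ + 1) / ‖v‖) • v) x
  rw [norm_smul, Real.norm_of_nonneg (by positivity), div_mul_cancel₀ _ hv'.ne',
    norm_sub_rev] at h2
  linarith [le_abs_self C]

lemma exitTime_nonneg (Ω : Set E3) (x v : E3) : 0 ≤ exitTime Ω x v :=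
  Real.sInf_nonneg fun _ ht => ht.1.le

/-- By convexity the ray leaves `Ω` once and for all, and by openness it has already left at the
exit time. Frontier membership and measurability both rest on this equivalence. -/
lemma lt_exitTime_iff (hΩ : IsPositivelyCurvedDomain Ω) (hx : x ∈ Ω) (hv : v ≠ 0) {t : ℝ}
    (ht : 0 ≤ t) : t < exitTime Ω x v ↔ x - t • v ∈ Ω := by
  refine ⟨fun h => ?_, fun h => ?_⟩
  · by_contra hn
    rcases ht.eq_or_lt with rfl | ht
    · exact hn (by simpa using hx)
    · have hbdd : BddBelow {t : ℝ | 0 < t ∧ x - t • v ∉ Ω} := ⟨0, fun s hs => hs.1.le⟩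
      exact h.not_ge (csInf_le hbdd ⟨ht, hn⟩)
  · have hcont : Tendsto (fun s : ℝ => x - s • v) (𝓝[>] t) (𝓝 (x - t • v)) := by
      refine Tendsto.mono_left ?_ nhdsWithin_le_nhds
      have : Continuous fun s : ℝ => x - s • v := by fun_prop
      exact this.tendsto t
    obtain ⟨s, hs, hts⟩ := ((hcont.eventually (hΩ.isOpen.mem_nhds h)).and
      self_mem_nhdsWithin).exists
    refine lt_of_lt_of_le hts (le_csInf (exists_pos_sub_smul_notMem hΩ.isBounded x hv) ?_)
    rintro u ⟨hu0, hu⟩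
    by_contra! hlt
    refine hu ?_
    have hs0 : 0 < s := hu0.trans hlt
    have := hΩ.convex.add_smul_sub_mem hx hs (t := u / s)
      ⟨by positivity, (div_le_one hs0).2 hlt.le⟩
    rwa [sub_sub_cancel_left, ← neg_smul, smul_smul, mul_neg, div_mul_cancel₀ _ hs0.ne', neg_smul,
      ← sub_eq_add_neg] at this

lemma exitTime_pos (hΩ : IsPositivelyCurvedDomain Ω) (hx : x ∈ Ω) (hv : v ≠ 0) :
    0 < exitTime Ω x v :=
  (lt_exitTime_iff hΩ hx hv le_rfl).2 (by simpa using hx)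

lemma exitPoint_mem_frontier (hΩ : IsPositivelyCurvedDomain Ω) (hx : x ∈ Ω) (hv : v ≠ 0) :
    exitPoint Ω x v ∈ frontier Ω := by
  have hpos := exitTime_pos hΩ hx hv
  rw [hΩ.isOpen.frontier_eq]
  refine ⟨?_, fun hmem => lt_irrefl _ ((lt_exitTime_iff hΩ hx hv hpos.le).2 hmem)⟩
  have hcont : Tendsto (fun s : ℝ => x - s • v) (𝓝[<] exitTime Ω x v)
      (𝓝 (exitPoint Ω x v)) := by
    refine Tendsto.mono_left ?_ nhdsWithin_le_nhds
    have : Continuous fun s : ℝ => x - s • v := by fun_prop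
    exact this.tendsto _
  refine mem_closure_of_tendsto hcont ?_
  filter_upwards [Ico_mem_nhdsLT hpos] with s hs
  exact (lt_exitTime_iff hΩ hx hv hs.1).1 hs.2

lemma exitPoint_mem_incomingBoundary (hΩ : IsPositivelyCurvedDomain Ω) (hx : x ∈ Ω)
    (hv : v ≠ 0) : (exitPoint Ω x v, v) ∈ incomingBoundary Ω := by
  have hfr := exitPoint_mem_frontier hΩ hx hv
  obtain ⟨φ, hφ⟩ := hΩ.boundary_contDiff _ hfr
  refine ⟨hfr, _, ⟨φ, hφ, rfl⟩, ?_⟩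
  have h1 := hφ.inner_gradient_neg hΩ.isOpen hΩ.convex hfr hx
  rw [exitPoint, sub_sub_cancel, real_inner_smul_right] at h1
  have h2 := neg_of_mul_neg_right h1 (exitTime_nonneg Ω x v)
  rw [real_inner_smul_left]
  exact mul_neg_of_pos_of_neg (inv_pos.2 (norm_pos_iff.2 hφ.gradient_ne_zero)) h2

lemma compl_nonempty_of_isBounded (hb : Bornology.IsBounded Ω) : Ωᶜ.Nonempty := by
  obtain ⟨t, -, ht⟩ := exists_pos_sub_smul_notMem hb 0 (v := EuclideanSpace.single 0 1)
    (by simp)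
  exact ⟨_, ht⟩

lemma infDist_compl_pos (hΩ : IsPositivelyCurvedDomain Ω) (hx : x ∈ Ω) :
    0 < Metric.infDist x Ωᶜ := by
  rw [← hΩ.isOpen.isClosed_compl.notMem_iff_infDist_pos
    (compl_nonempty_of_isBounded hΩ.isBounded)]
  simpa using hx

/-- The projection of `x` onto the plane through `a` normal to `n` lies outside `Ω`: there the
enclosing inequality would force it to equal `a`. -/
lemma IsEnclosedAt.infDist_compl_le {R : ℝ} {a n : E3} (h : IsEnclosedAt Ω R a n) (ha : a ∉ Ω)
    (hR : 0 < R) (hx : x ∈ Ω) : Metric.infDist x Ωᶜ ≤ ⟪n, a - x⟫ := by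
  have hnn : 0 ≤ ⟪n, a - x⟫ := by
    by_contra! hlt
    nlinarith [h.2 x hx, sq_nonneg ‖x - a‖]
  have hmem : x + ⟪n, a - x⟫ • n ∈ Ωᶜ := fun hmem => by
    have h1 := h.2 _ hmem
    rw [← sub_sub, inner_sub_right n (a - x), real_inner_smul_right, real_inner_self_eq_norm_sq,
      h.1, one_pow, mul_one, sub_self, mul_zero] at h1
    have h2 := norm_eq_zero.1 (pow_eq_zero_iff two_ne_zero |>.1 (le_antisymm h1 (sq_nonneg _)))
    rw [sub_eq_zero.1 h2] at hmem
    exact ha hmem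
  refine (Metric.infDist_le_dist_of_mem hmem).trans (le_of_eq ?_)
  rw [dist_eq_norm, sub_add_cancel_left, norm_neg, norm_smul, h.1, mul_one,
    Real.norm_of_nonneg hnn]

lemma IsEnclosedAt.infDist_compl_le_radius {R : ℝ} {a n : E3} (h : IsEnclosedAt Ω R a n)
    (ha : a ∉ Ω) (hR : 0 < R) (hx : x ∈ Ω) : Metric.infDist x Ωᶜ ≤ R := by
  have h1 := h.infDist_compl_le ha hR hx
  have h2 := real_inner_le_norm n (a - x)
  have h3 := h.2 x hx
  rw [h.1, one_mul] at h2
  rw [norm_sub_rev] at h3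
  have h4 : 0 < ‖a - x‖ := norm_pos_iff.2 (sub_ne_zero.2 fun h => ha (h ▸ hx))
  nlinarith

/-- One-sided Lipschitz bound for the backward chord length, with a constant that depends on the
distance to the boundary only. -/
lemma exitTime_sub_le (hΩ : IsPositivelyCurvedDomain Ω) {R : ℝ} (hR : 0 < R)
    (H : ∀ a ∈ frontier Ω, ∃ n, IsEnclosedAt Ω R a n) (hx : x ∈ Ω) (hy : y ∈ Ω) (hv : v ≠ 0) :
    (exitTime Ω y v - exitTime Ω x v) * ‖v‖ * √(Metric.infDist x Ωᶜ) ≤ √R * ‖x - y‖ := by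
  rcases le_total (exitTime Ω y v) (exitTime Ω x v) with hle | hle
  · have : (exitTime Ω y v - exitTime Ω x v) * ‖v‖ * √(Metric.infDist x Ωᶜ) ≤ 0 :=
      mul_nonpos_of_nonpos_of_nonneg
        (mul_nonpos_of_nonpos_of_nonneg (by linarith) (norm_nonneg _)) (Real.sqrt_nonneg _)
    exact this.trans (by positivity)
  have hfx := exitPoint_mem_frontier hΩ hx hv
  have hfy := exitPoint_mem_frontier hΩ hy hv
  have hnot : exitPoint Ω x v ∉ Ω := by
    rw [hΩ.isOpen.frontier_eq] at hfx; exact hfx.2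
  obtain ⟨n, hn⟩ := H _ hfx
  set N := -⟪n, v⟫ with hN
  have hτ := exitTime_pos hΩ hx hv
  have hd := hn.infDist_compl_le hnot hR hx
  have hball := hn.2 x hx
  -- The exit point of `y` is in the closure of `Ω`, hence on the inner side of the plane at the
  -- exit point of `x`.
  have hcl : 0 ≤ ⟪n, exitPoint Ω x v - exitPoint Ω y v⟫ := by
    refine closure_minimal (t := {b | 0 ≤ ⟪n, exitPoint Ω x v - b⟫}) (fun b hb => ?_)
      (isClosed_le continuous_const (by fun_prop)) hfy.1
    exact nonneg_of_mul_nonneg_right ((sq_nonneg _).trans (hn.2 b hb)) hR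
  have h1 : ⟪n, exitPoint Ω x v - x⟫ = exitTime Ω x v * N := by
    rw [exitPoint, sub_sub_cancel_left, inner_neg_right, real_inner_smul_right, hN]; ring
  rw [h1] at hd hball
  have h2 : ‖x - exitPoint Ω x v‖ = exitTime Ω x v * ‖v‖ := by
    rw [exitPoint, sub_sub_cancel, norm_smul, Real.norm_of_nonneg hτ.le]
  rw [h2] at hball
  have hv' : 0 < ‖v‖ := norm_pos_iff.2 hv
  have h3 : exitTime Ω x v * ‖v‖ ^ 2 ≤ R * N := by
    refine le_of_mul_le_mul_left ?_ hτ
    linarith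
  have hN0 : 0 < N := by
    refine pos_of_mul_pos_right (a := R) (lt_of_lt_of_le ?_ h3) hR.le
    positivity
  -- Eliminating the exit time between `d ≤ τ N` and `τ ‖v‖² ≤ R N` bounds the normal speed below by
  -- the distance to the boundary.
  have h4 : Metric.infDist x Ωᶜ * ‖v‖ ^ 2 ≤ R * N ^ 2 := by
    calc Metric.infDist x Ωᶜ * ‖v‖ ^ 2 ≤ exitTime Ω x v * N * ‖v‖ ^ 2 := by gcongr
      _ = exitTime Ω x v * ‖v‖ ^ 2 * N := by ring
      _ ≤ R * N * N := by gcongr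
      _ = R * N ^ 2 := by ring
  have h5 : ‖v‖ * √(Metric.infDist x Ωᶜ) ≤ √R * N := by
    have := Real.sqrt_le_sqrt h4
    rwa [Real.sqrt_mul Metric.infDist_nonneg, Real.sqrt_mul hR.le, Real.sqrt_sq hv'.le,
      Real.sqrt_sq hN0.le, mul_comm] at this
  have h6 : (exitTime Ω y v - exitTime Ω x v) * N ≤ ‖x - y‖ := by
    have h7 : exitPoint Ω x v - exitPoint Ω y v
        = (x - y) + (exitTime Ω y v - exitTime Ω x v) • v := by
      simp only [exitPoint, sub_smul]; abel
    rw [h7, inner_add_right, real_inner_smul_right] at hcl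
    have h8 := real_inner_le_norm n (x - y)
    rw [hn.1, one_mul] at h8
    rw [hN]
    linarith
  calc (exitTime Ω y v - exitTime Ω x v) * ‖v‖ * √(Metric.infDist x Ωᶜ)
      = (exitTime Ω y v - exitTime Ω x v) * (‖v‖ * √(Metric.infDist x Ωᶜ)) := by ring
    _ ≤ (exitTime Ω y v - exitTime Ω x v) * (√R * N) :=
        mul_le_mul_of_nonneg_left h5 (by linarith)
    _ = √R * ((exitTime Ω y v - exitTime Ω x v) * N) := by ring
    _ ≤ _ := by gcongr

lemma abs_exitTime_sub_le (hΩ : IsPositivelyCurvedDomain Ω) {R : ℝ} (hR : 0 < R)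
    (H : ∀ a ∈ frontier Ω, ∃ n, IsEnclosedAt Ω R a n) (hx : x ∈ Ω) (hy : y ∈ Ω) (hv : v ≠ 0) :
    |exitTime Ω x v - exitTime Ω y v| * ‖v‖
      ≤ √R * ‖x - y‖ * ((√(Metric.infDist x Ωᶜ))⁻¹ + (√(Metric.infDist y Ωᶜ))⁻¹) := by
  have hdx := Real.sqrt_pos.2 (infDist_compl_pos hΩ hx)
  have hdy := Real.sqrt_pos.2 (infDist_compl_pos hΩ hy)
  have h1 := exitTime_sub_le hΩ hR H hx hy hv
  have h2 := exitTime_sub_le hΩ hR H hy hx hv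
  rw [← le_div_iff₀ hdx] at h1
  rw [← le_div_iff₀ hdy, norm_sub_rev] at h2
  have h3 : 0 ≤ √R * ‖x - y‖ / √(Metric.infDist x Ωᶜ) := by positivity
  have h4 : 0 ≤ √R * ‖x - y‖ / √(Metric.infDist y Ωᶜ) := by positivity
  rw [mul_add, ← div_eq_mul_inv, ← div_eq_mul_inv]
  rcases abs_cases (exitTime Ω x v - exitTime Ω y v) with ⟨h, -⟩ | ⟨h, -⟩ <;> rw [h]
  · linarith
  · rw [neg_sub]; linarith

lemma norm_exitPoint_sub_le (hΩ : IsPositivelyCurvedDomain Ω) {R : ℝ} (hR : 0 < R)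
    (H : ∀ a ∈ frontier Ω, ∃ n, IsEnclosedAt Ω R a n) (hx : x ∈ Ω) (hy : y ∈ Ω) (hv : v ≠ 0) :
    ‖exitPoint Ω x v - exitPoint Ω y v‖
      ≤ 2 * (√R * ‖x - y‖ * ((√(Metric.infDist x Ωᶜ))⁻¹ + (√(Metric.infDist y Ωᶜ))⁻¹)) := by
  have h1 : exitPoint Ω x v - exitPoint Ω y v
      = (x - y) - (exitTime Ω x v - exitTime Ω y v) • v := by
    simp only [exitPoint, sub_smul]; abel
  have hfx := exitPoint_mem_frontier hΩ hx hv
  have hnot : exitPoint Ω x v ∉ Ω := by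
    rw [hΩ.isOpen.frontier_eq] at hfx; exact hfx.2
  obtain ⟨n, hn⟩ := H _ hfx
  have hdx := Real.sqrt_pos.2 (infDist_compl_pos hΩ hx)
  -- Since `d ≤ R`, the plain term `‖x - y‖` is absorbed into the weighted one.
  have h2 : 1 ≤ √R * (√(Metric.infDist x Ωᶜ))⁻¹ := by
    rw [← div_eq_mul_inv, one_le_div hdx]
    exact Real.sqrt_le_sqrt (hn.infDist_compl_le_radius hnot hR hx)
  have h3 : ‖x - y‖
      ≤ √R * ‖x - y‖ * ((√(Metric.infDist x Ωᶜ))⁻¹ + (√(Metric.infDist y Ωᶜ))⁻¹) := by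
    have h4 : 0 ≤ √R * (√(Metric.infDist y Ωᶜ))⁻¹ := by positivity
    nlinarith [norm_nonneg (x - y)]
  have h5 := abs_exitTime_sub_le hΩ hR H hx hy hv
  rw [h1]
  refine (norm_sub_le _ _).trans ?_
  rw [norm_smul, Real.norm_eq_abs]
  linarith

lemma measurable_exitTime_subtype (hΩ : IsPositivelyCurvedDomain Ω) :
    Measurable fun p : (Ω ×ˢ ({0}ᶜ : Set E3) : Set (E3 × E3)) => exitTime Ω p.1.1 p.1.2 := by
  refine measurable_of_Ioi fun t => ?_
  rcases lt_or_ge t 0 with ht | ht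
  · convert MeasurableSet.univ
    exact eq_univ_of_forall fun p => ht.trans_le (exitTime_nonneg _ _ _)
  · have : (fun p : (Ω ×ˢ ({0}ᶜ : Set E3) : Set (E3 × E3)) => exitTime Ω p.1.1 p.1.2) ⁻¹' Ioi t
        = (fun p : (Ω ×ˢ ({0}ᶜ : Set E3) : Set (E3 × E3)) => p.1.1 - t • p.1.2) ⁻¹' Ω := by
      ext p
      exact lt_exitTime_iff hΩ p.2.1 p.2.2 ht
    rw [this]
    exact (hΩ.isOpen.preimage (by fun_prop)).measurableSet

lemma restrict_prod_volume_eq (Ω : Set E3) : (volume.restrict Ω).prod (volume : Measure E3)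
    = (volume.prod volume).restrict (Ω ×ˢ ({0}ᶜ : Set E3)) := by
  rw [← Measure.prod_restrict, restrict_compl_singleton]

lemma IsPositivelyCurvedDomain.measurableSet_prod (hΩ : IsPositivelyCurvedDomain Ω) :
    MeasurableSet (Ω ×ˢ ({0}ᶜ : Set E3)) :=
  hΩ.isOpen.measurableSet.prod (measurableSet_singleton _).compl

/-- `g` is measurable only on the incoming boundary, so the map to the exit point is built with
values in that subtype, which requires discarding `v = 0`. -/
lemma aemeasurable_incomingTransport (hΩ : IsPositivelyCurvedDomain Ω) {ν : E3 → ℝ}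
    (hν : Measurable ν) {g : E3 → E3 → ℝ}
    (hg : Measurable fun p : incomingBoundary Ω => g p.1.1 p.1.2) :
    AEMeasurable (Function.uncurry (incomingTransport Ω ν g))
      ((volume.restrict Ω).prod volume) := by
  rw [restrict_prod_volume_eq]
  refine aemeasurable_restrict_of_measurable_subtype hΩ.measurableSet_prod ?_
  have hτ := measurable_exitTime_subtype hΩ
  have hv : Measurable fun p : (Ω ×ˢ ({0}ᶜ : Set E3) : Set (E3 × E3)) => p.1.2 := by fun_prop
  have hx : Measurable fun p : (Ω ×ˢ ({0}ᶜ : Set E3) : Set (E3 × E3)) => p.1.1 := by fun_prop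
  have hq : Measurable fun p : (Ω ×ˢ ({0}ᶜ : Set E3) : Set (E3 × E3)) =>
      (⟨(exitPoint Ω p.1.1 p.1.2, p.1.2),
        exitPoint_mem_incomingBoundary hΩ p.2.1 p.2.2⟩ : incomingBoundary Ω) :=
    ((hx.sub (hτ.smul hv)).prodMk hv).subtype_mk
  exact (Real.measurable_exp.comp ((hν.comp hv).neg.mul hτ)).mul (hg.comp hq)

end ExitTime

/-! ### Integrability of the spatial and velocity weights. -/

section Integrals

variable {Ω : Set E3}

/-- Boundary layers of a bounded convex set have volume at most linear in their width. -/
lemma exists_volume_boundaryLayer_le (ho : IsOpen Ω) (hb : Bornology.IsBounded Ω)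
    (hc : Convex ℝ Ω) : ∃ C : ℝ, 0 ≤ C ∧ ∀ s : ℝ, 0 < s →
      volume (Ω ∩ {x | Metric.infDist x Ωᶜ < s}) ≤ ENNReal.ofReal (C * s) := by
  rcases Ω.eq_empty_or_nonempty with rfl | ⟨x₀, hx₀⟩
  · exact ⟨0, le_rfl, by simp⟩
  obtain ⟨r, hr, hball⟩ := Metric.isOpen_iff.1 ho x₀ hx₀
  have hV : volume Ω ≠ ∞ := hb.measure_lt_top.ne
  set V := (volume Ω).toReal
  have hVV : volume Ω = ENNReal.ofReal V := (ENNReal.ofReal_toReal hV).symm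
  have hV0 : 0 ≤ V := ENNReal.toReal_nonneg
  refine ⟨3 * V / r, by positivity, fun s hs => ?_⟩
  set l := s / r with hl
  have hl0 : 0 < l := by positivity
  rcases le_or_gt 1 l with hl1 | hl1
  · refine (measure_mono inter_subset_left).trans ?_
    rw [hVV]
    refine ENNReal.ofReal_le_ofReal ?_
    have : 3 * V / r * s = 3 * V * l := by rw [hl]; ring
    rw [this]
    nlinarith
  -- `Ω` contains `(1 - l) Ω + l B(x₀, r)`, so points of the shrunken copy have distance at least `l
  -- r = s` to the complement. The layer therefore lies in `Ω \ T '' Ω`, of volume `(1 - (1 - l)³) V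
  -- ≤ 3 l V`.
  · set T := AffineMap.homothety x₀ (1 - l)
    have hT : ∀ x, T x = x₀ + (1 - l) • (x - x₀) := fun x => by
      simp [T, AffineMap.homothety_apply, add_comm]
    have hTΩ : T '' Ω ⊆ Ω := by
      rintro _ ⟨x, hx, rfl⟩
      rw [hT]
      exact hc.add_smul_sub_mem hx₀ hx ⟨by linarith, by linarith⟩
    have hsub : Ω ∩ {x | Metric.infDist x Ωᶜ < s} ⊆ Ω \ T '' Ω := by
      rintro z ⟨hz, hzs⟩
      refine ⟨hz, ?_⟩
      rintro ⟨x, hx, rfl⟩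
      refine not_le.2 (show Metric.infDist (T x) Ωᶜ < s from hzs) ?_
      rw [Metric.le_infDist (compl_nonempty_of_isBounded hb)]
      intro u hu
      by_contra! hlt
      refine hu ?_
      have hmem : x₀ + l⁻¹ • (u - T x) ∈ Ω := by
        refine hball ?_
        rw [mem_ball_iff_norm, add_sub_cancel_left, norm_smul, Real.norm_of_nonneg (by positivity)]
        rw [dist_comm, dist_eq_norm] at hlt
        rw [inv_mul_lt_iff₀ hl0]
        refine hlt.trans_le (le_of_eq ?_)
        rw [hl]; field_simp
      have := hc hx hmem (a := 1 - l) (b := l) (by linarith) hl0.le (by ring)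
      convert this using 1
      rw [smul_add, smul_smul, mul_inv_cancel₀ hl0.ne', one_smul, hT]
      module
    have hopen : IsOpen (T '' Ω) := AffineMap.homothety_isOpenMap x₀ _ (by linarith) _ ho
    refine (measure_mono hsub).trans ?_
    rw [measure_sdiff hTΩ hopen.measurableSet.nullMeasurableSet
      (ne_top_of_le_ne_top hV (measure_mono hTΩ)), Measure.addHaar_image_homothety, hVV,
      ← ENNReal.ofReal_mul (abs_nonneg _), ← ENNReal.ofReal_sub _ (by positivity)]
    refine ENNReal.ofReal_le_ofReal ?_
    have h1 : |(1 - l) ^ Module.finrank ℝ E3| = (1 - l) ^ 3 := by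
      rw [finrank_euclideanSpace_fin, abs_of_nonneg (by have : 0 < 1 - l := by linarith
                                                        positivity)]
    have h2 : 1 - 3 * l ≤ (1 - l) ^ 3 := by nlinarith [mul_pos hl0 hl0]
    have h3 : 3 * V / r * s = 3 * V * l := by rw [hl]; ring
    rw [h1, h3]
    nlinarith

/-- Layer cake: `{d⁻¹ > t}` is a boundary layer of width `1 / t`, so the tail integrand is `O(t^(β -
2))`, integrable as `β < 1`; near `0` the finite volume and `t^(β - 1)` suffice. -/
lemma lintegral_inv_infDist_rpow_lt_top (ho : IsOpen Ω) (hb : Bornology.IsBounded Ω)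
    (hc : Convex ℝ Ω) {β : ℝ} (hβ : 0 < β) (hβ1 : β < 1) :
    ∫⁻ x in Ω, ENNReal.ofReal ((Metric.infDist x Ωᶜ)⁻¹ ^ β) < ∞ := by
  obtain ⟨C, hC, hlayer⟩ := exists_volume_boundaryLayer_le ho hb hc
  have hm : Measurable fun x : E3 => (Metric.infDist x Ωᶜ)⁻¹ :=
    (Metric.continuous_infDist_pt _).measurable.inv
  rw [lintegral_rpow_eq_lintegral_meas_lt_mul _
    (Eventually.of_forall fun x => inv_nonneg.2 Metric.infDist_nonneg) hm.aemeasurable hβ]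
  refine ENNReal.mul_lt_top ENNReal.ofReal_lt_top ?_
  rw [← Ioc_union_Ioi_eq_Ioi zero_le_one]
  refine (lintegral_union_le _ _ _).trans_lt (ENNReal.add_lt_top.2 ⟨?_, ?_⟩)
  · refine (lintegral_mono (g := fun t => volume Ω * ENNReal.ofReal (t ^ (β - 1)))
      fun t => ?_).trans_lt ?_
    · refine mul_le_mul_left ?_ _
      exact (measure_mono (subset_univ _)).trans (by simp)
    · rw [lintegral_const_mul' _ _ hb.measure_lt_top.ne]
      refine ENNReal.mul_lt_top hb.measure_lt_top ?_
      have := (intervalIntegral.intervalIntegrable_rpow' (a := 0) (b := 1) (r := β - 1)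
        (by linarith)).1
      exact this.lintegral_lt_top
  · refine (setLIntegral_mono' (g := fun t => ENNReal.ofReal C * ENNReal.ofReal (t ^ (β - 2)))
      measurableSet_Ioi fun t ht => ?_).trans_lt ?_
    · have ht0 : (0 : ℝ) < t := zero_lt_one.trans ht
      have hle : volume.restrict Ω {a | t < (Metric.infDist a Ωᶜ)⁻¹}
          ≤ ENNReal.ofReal (C * t⁻¹) := by
        rw [Measure.restrict_apply (measurableSet_lt measurable_const hm), inter_comm]
        refine (measure_mono ?_).trans (hlayer t⁻¹ (by positivity))
        rintro x ⟨hx, hxt⟩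
        refine ⟨hx, ?_⟩
        have hpos : 0 < Metric.infDist x Ωᶜ := inv_pos.1 (ht0.trans hxt)
        exact (lt_inv_comm₀ ht0 hpos).1 hxt
      refine (mul_le_mul_left hle _).trans (le_of_eq ?_)
      rw [← ENNReal.ofReal_mul (by positivity), ← ENNReal.ofReal_mul hC, mul_assoc,
        ← Real.rpow_neg_one t, ← Real.rpow_add ht0]
      ring_nf
    · rw [lintegral_const_mul' _ _ ENNReal.ofReal_ne_top]
      refine ENNReal.mul_lt_top ENNReal.ofReal_lt_top ?_
      exact (integrableOn_Ioi_rpow_of_lt (by linarith) one_pos).lintegral_lt_top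

lemma lintegral_ball_norm_rpow_lt_top {α : ℝ} (hα : α < 3) (D : ℝ) :
    ∫⁻ x in Metric.ball (0 : E3) D, ENNReal.ofReal (‖x‖ ^ (-α)) < ∞ := by
  refine IntegrableOn.setLIntegral_lt_top (f := fun x : E3 => ‖x‖ ^ (-α)) ?_
  refine integrableOn_ball_of_norm_le_rpow (C := 1) (α := α) (by simp) (by simpa using hα) ?_ ?_
  · filter_upwards with x
    rw [one_mul, Real.norm_of_nonneg (by positivity)]
  · exact (measurable_norm.pow_const _).aestronglyMeasurable

lemma setLIntegral_norm_sub_rpow_le {α D : ℝ} (ho : MeasurableSet Ω) {y : E3}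
    (hD : ∀ x ∈ Ω, ‖x - y‖ < D) :
    ∫⁻ x in Ω, ENNReal.ofReal (‖x - y‖ ^ (-α))
      ≤ ∫⁻ x in Metric.ball (0 : E3) D, ENNReal.ofReal (‖x‖ ^ (-α)) := by
  rw [← lintegral_indicator Metric.isOpen_ball.measurableSet,
    ← lintegral_indicator ho, ← lintegral_sub_right_eq_self
      ((Metric.ball (0 : E3) D).indicator fun x => ENNReal.ofReal (‖x‖ ^ (-α))) y]
  refine lintegral_mono fun x => ?_
  by_cases hx : x ∈ Ω
  · rw [indicator_of_mem hx, indicator_of_mem (by simpa using hD x hx)]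
  · rw [indicator_of_notMem hx]; exact zero_le

/-- The kernel has integral over `Ω` bounded uniformly in the other variable, which settles the `D
y` term; Tonelli and symmetry turn the `D x` term into it. -/
lemma lintegral_lintegral_weighted_lt_top (ho : IsOpen Ω) (hb : Bornology.IsBounded Ω)
    {D : E3 → ℝ≥0∞} (hDm : Measurable D) (hD : ∫⁻ x in Ω, D x < ∞) {α : ℝ} (hα : α < 3) :
    ∫⁻ y in Ω, ∫⁻ x in Ω, (D x + D y) * ENNReal.ofReal (‖x - y‖ ^ (-α)) < ∞ := by
  obtain ⟨r, hr⟩ : ∃ r, ∀ x ∈ Ω, ∀ y ∈ Ω, ‖x - y‖ < r :=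
    ⟨Metric.diam Ω + 1, fun x hx y hy => by
      rw [← dist_eq_norm]
      linarith [Metric.dist_le_diam_of_mem hb hx hy]⟩
  set I := ∫⁻ x in Metric.ball (0 : E3) r, ENNReal.ofReal (‖x‖ ^ (-α))
  have hI : I < ∞ := lintegral_ball_norm_rpow_lt_top hα r
  have hk : ∀ y : E3, Measurable fun x : E3 => ENNReal.ofReal (‖x - y‖ ^ (-α)) := fun y =>
    ((measurable_id.sub_const y).norm.pow_const _).ennreal_ofReal
  have hjoint : Measurable fun p : E3 × E3 => D p.2 * ENNReal.ofReal (‖p.2 - p.1‖ ^ (-α)) :=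
    (hDm.comp measurable_snd).mul
      ((measurable_snd.sub measurable_fst).norm.pow_const _).ennreal_ofReal
  have hle : ∀ y ∈ Ω, ∫⁻ x in Ω, ENNReal.ofReal (‖x - y‖ ^ (-α)) ≤ I := fun y hy =>
    setLIntegral_norm_sub_rpow_le ho.measurableSet fun x hx => hr x hx y hy
  have hsecond : ∫⁻ y in Ω, ∫⁻ x in Ω, D y * ENNReal.ofReal (‖x - y‖ ^ (-α)) < ∞ := by
    refine (setLIntegral_mono' (g := fun y => D y * I) ho.measurableSet fun y hy => ?_).trans_lt ?_
    · rw [lintegral_const_mul _ (hk y)]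
      exact mul_le_mul_right (hle y hy) _
    · rw [lintegral_mul_const' _ _ hI.ne]
      exact ENNReal.mul_lt_top hD hI
  have hfirst : ∫⁻ y in Ω, ∫⁻ x in Ω, D x * ENNReal.ofReal (‖x - y‖ ^ (-α)) < ∞ := by
    rw [lintegral_lintegral_swap (f := fun y x => D x * ENNReal.ofReal (‖x - y‖ ^ (-α)))
      hjoint.aemeasurable]
    refine lt_of_eq_of_lt ?_ hsecond
    refine lintegral_congr fun x => lintegral_congr fun y => ?_
    rw [norm_sub_rev]
  have hsplit : ∫⁻ y in Ω, ∫⁻ x in Ω, (D x + D y) * ENNReal.ofReal (‖x - y‖ ^ (-α))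
      = ∫⁻ y in Ω, ((∫⁻ x in Ω, D x * ENNReal.ofReal (‖x - y‖ ^ (-α)))
        + ∫⁻ x in Ω, D y * ENNReal.ofReal (‖x - y‖ ^ (-α))) := by
    refine lintegral_congr fun y => ?_
    simp only [add_mul]
    exact lintegral_add_left (hDm.mul (hk y)) _
  rw [hsplit, lintegral_add_left hjoint.lintegral_prod_right']
  exact ENNReal.add_lt_top.2 ⟨hfirst, hsecond⟩

lemma integrable_norm_rpow_mul_exp_neg_mul_sq {b s : ℝ} (hb : 0 < b) (hs : -3 < s) :
    Integrable fun v : E3 => ‖v‖ ^ s * Real.exp (-b * ‖v‖ ^ 2) := by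
  rw [integrable_fun_norm_addHaar volume (f := fun r : ℝ => r ^ s * Real.exp (-b * r ^ 2))]
  refine (integrableOn_rpow_mul_exp_neg_mul_sq hb (s := s + 2) (by linarith)).congr_fun ?_
    measurableSet_Ioi
  intro r hr
  have hr : 0 < r := hr
  simp only [finrank_euclideanSpace_fin, smul_eq_mul]
  rw [← mul_assoc, Real.rpow_add hr]
  norm_num
  ring

end Integrals

/-! ### The collision frequency: sign, measurability, linear growth. -/

section CollisionFrequency

lemma maxwellian_nonneg (w : E3) : 0 ≤ maxwellian w := by
  unfold maxwellian; positivity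

variable {γ : ℝ} {B : ℝ → ℝ → ℝ}

lemma measurable_collisionFrequency (hB : Measurable (Function.uncurry B)) :
    Measurable (collisionFrequency B) := by
  have h1 : Measurable fun p : (E3 × E3) × ℝ =>
      maxwellian p.1.2 * B ‖p.1.1 - p.1.2‖ p.2 := by
    refine Measurable.mul ?_ (hB.comp (f := fun p : (E3 × E3) × ℝ => (‖p.1.1 - p.1.2‖, p.2))
      (by fun_prop))
    unfold maxwellian
    fun_prop
  have h2 := (h1.stronglyMeasurable.integral_prod_right'
    (ν := volume.restrict (Ioc 0 (Real.pi / 2)))).const_mul (2 * Real.pi)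
  have h3 := (h2.integral_prod_right' (ν := (volume : Measure E3))).measurable
  convert h3 using 2 with v
  simp only [collisionFrequency, intervalIntegral.integral_const, sub_zero, smul_eq_mul]
  simp_rw [intervalIntegral.integral_of_le Real.pi_div_two_pos.le]

lemma collisionFrequency_nonneg (hB : IsCutoffCrossSection γ B) (v : E3) :
    0 ≤ collisionFrequency B v := by
  obtain ⟨C, hC, hbd⟩ := hB.bound
  refine integral_nonneg_of_ae ?_
  filter_upwards [compl_mem_ae_iff.2 (measure_singleton v)]
    with w hw
  have hr : 0 < ‖v - w‖ := norm_pos_iff.2 (sub_ne_zero.2 fun h => hw h.symm)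
  refine intervalIntegral.integral_nonneg (by positivity) fun _ _ =>
    intervalIntegral.integral_nonneg (by positivity) fun θ hθ => ?_
  exact mul_nonneg (maxwellian_nonneg w) (hbd _ θ hr hθ).1

lemma exists_collisionFrequency_le (hB : IsCutoffCrossSection γ B) :
    ∃ C : ℝ, 0 ≤ C ∧ ∀ v, collisionFrequency B v ≤ C * (1 + ‖v‖) := by
  obtain ⟨C, hC, hbd⟩ := hB.bound
  have hint : Integrable fun w : E3 => maxwellian w * (1 + ‖w‖) := by
    have h0 := integrable_norm_rpow_mul_exp_neg_mul_sq (b := 1) (s := 0) one_pos (by norm_num)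
    have h1 := integrable_norm_rpow_mul_exp_neg_mul_sq (b := 1) (s := 1) one_pos (by norm_num)
    refine ((h0.add h1).const_mul (Real.pi ^ (-(3 / 2) : ℝ))).congr ?_
    filter_upwards with w
    simp only [Pi.add_apply, Real.rpow_zero, Real.rpow_one, maxwellian, neg_mul, one_mul]
    ring
  refine ⟨2 * Real.pi * (Real.pi / 2) * C * ∫ w : E3, maxwellian w * (1 + ‖w‖), ?_, fun v => ?_⟩
  · have : 0 ≤ ∫ w : E3, maxwellian w * (1 + ‖w‖) :=
      integral_nonneg fun w => mul_nonneg (maxwellian_nonneg w) (by positivity)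
    positivity
  have hle := norm_integral_le_of_norm_le
    (hint.const_mul (2 * Real.pi * (Real.pi / 2) * C * (1 + ‖v‖)))
    (f := fun w : E3 => ∫ _ϵ in (0 : ℝ)..(2 * Real.pi), ∫ θ in (0 : ℝ)..(Real.pi / 2),
      maxwellian w * B ‖v - w‖ θ) (by
    filter_upwards [compl_mem_ae_iff.2 (measure_singleton v)] with w hw
    have hr : 0 < ‖v - w‖ := norm_pos_iff.2 (sub_ne_zero.2 fun h => hw h.symm)
    have hM := maxwellian_nonneg w
    -- Here `0 ≤ γ ≤ 1` enters: `r ^ γ ≤ 1 + r`, which leaves a first moment of the Maxwellian.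
    have hrγ : ‖v - w‖ ^ γ ≤ (1 + ‖v‖) * (1 + ‖w‖) := by
      have h1 : ‖v - w‖ ^ γ ≤ 1 + ‖v - w‖ := by
        rcases le_total ‖v - w‖ 1 with h | h
        · have := Real.rpow_le_one hr.le h hB.exponent_mem.1
          linarith
        · have := Real.rpow_le_rpow_of_exponent_le h hB.exponent_mem.2
          rw [Real.rpow_one] at this
          linarith
      nlinarith [norm_sub_le v w, norm_nonneg v, norm_nonneg w]
    have hin : ‖∫ θ in (0 : ℝ)..(Real.pi / 2), maxwellian w * B ‖v - w‖ θ‖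
        ≤ maxwellian w * (C * ((1 + ‖v‖) * (1 + ‖w‖))) * |Real.pi / 2 - 0| := by
      refine intervalIntegral.norm_integral_le_of_norm_le_const fun θ hθ => ?_
      rw [uIoc_of_le Real.pi_div_two_pos.le] at hθ
      obtain ⟨h0, h1⟩ := hbd _ θ hr ⟨hθ.1.le, hθ.2⟩
      rw [Real.norm_of_nonneg (mul_nonneg hM h0)]
      gcongr
      refine h1.trans ?_
      have hsin : 0 ≤ Real.sin θ :=
        Real.sin_nonneg_of_nonneg_of_le_pi hθ.1.le (by linarith [hθ.2, Real.pi_pos])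
      calc C * ‖v - w‖ ^ γ * Real.cos θ * Real.sin θ
          ≤ C * ‖v - w‖ ^ γ * 1 * 1 := by
            gcongr
            · exact Real.cos_le_one θ
            · exact Real.sin_le_one θ
        _ = C * ‖v - w‖ ^ γ := by ring
        _ ≤ _ := by gcongr
    refine (intervalIntegral.norm_integral_le_of_norm_le_const fun _ _ => hin).trans
      (le_of_eq ?_)
    rw [sub_zero, sub_zero, abs_of_pos (by positivity), abs_of_pos (by positivity)]
    ring)
  rw [integral_const_mul] at hle
  exact (le_abs_self _).trans (hle.trans (le_of_eq (by ring)))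

end CollisionFrequency

lemma abs_exp_neg_sub_exp_neg_le {s t : ℝ} (hs : 0 ≤ s) (ht : 0 ≤ t) :
    |Real.exp (-s) - Real.exp (-t)| ≤ |s - t| := by
  wlog h : s ≤ t generalizing s t
  · rw [abs_sub_comm, abs_sub_comm s t]
    exact this ht hs (le_of_not_ge h)
  have h1 : Real.exp (-t) = Real.exp (-s) * Real.exp (-(t - s)) := by
    rw [← Real.exp_add]; ring_nf
  have h2 : Real.exp (-s) ≤ 1 := Real.exp_le_one_iff.2 (by linarith)
  have h3 := Real.add_one_le_exp (-(t - s))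
  have h4 : Real.exp (-(t - s)) ≤ 1 := Real.exp_le_one_iff.2 (by linarith)
  rw [abs_of_nonpos (by linarith : s - t ≤ 0), h1, abs_of_nonneg (by
    nlinarith [Real.exp_pos (-s)])]
  nlinarith [Real.exp_pos (-s)]

lemma add_rpow_le_four_mul {a b p : ℝ} (ha : 0 ≤ a) (hb : 0 ≤ b) (hp : 0 ≤ p) (hp2 : p ≤ 2) :
    (a + b) ^ p ≤ 4 * (a ^ p + b ^ p) := by
  have key : ∀ {c : ℝ}, 0 ≤ c → (2 * c) ^ p ≤ 4 * c ^ p := fun {c} hc => by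
    rw [Real.mul_rpow zero_le_two hc]
    have : (2 : ℝ) ^ p ≤ 2 ^ (2 : ℝ) := Real.rpow_le_rpow_of_exponent_le one_le_two hp2
    norm_num at this
    gcongr
  have ha' := Real.rpow_nonneg ha p
  have hb' := Real.rpow_nonneg hb p
  rcases le_total a b with h | h
  · calc (a + b) ^ p ≤ (2 * b) ^ p := Real.rpow_le_rpow (by positivity) (by linarith) hp
      _ ≤ 4 * b ^ p := key hb
      _ ≤ _ := by linarith
  · calc (a + b) ^ p ≤ (2 * a) ^ p := Real.rpow_le_rpow (by positivity) (by linarith) hp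
      _ ≤ 4 * a ^ p := key ha
      _ ≤ _ := by linarith

/-- Interpolation between a uniform bound and a Lipschitz type bound. -/
lemma sq_le_rpow_mul_rpow {Δ A B ε : ℝ} (hΔ : 0 ≤ Δ) (hA : Δ ≤ A) (hB : Δ ≤ B) (hε : 0 < ε)
    (hε1 : ε < 1) : Δ ^ 2 ≤ A ^ ε * B ^ (2 - ε) := by
  have h : Δ ^ 2 = Δ ^ ε * Δ ^ (2 - ε) := by
    rw [← Real.rpow_add' hΔ (by norm_num)]
    norm_num
  rw [h]
  have h1 : 0 ≤ 2 - ε := by linarith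
  have h2 : 0 ≤ A := hΔ.trans hA
  gcongr

/-! ### Estimates on `Jg` and the Gagliardo integral. -/

section Transport

variable {Ω : Set E3} {γ : ℝ} {B : ℝ → ℝ → ℝ} {g : E3 → E3 → ℝ} {a C : ℝ}

lemma abs_incomingTransport_le (hΩ : IsPositivelyCurvedDomain Ω) {ν : E3 → ℝ}
    (hν : ∀ v, 0 ≤ ν v)
    (hg : ∀ q v : E3, (q, v) ∈ incomingBoundary Ω → |g q v| ≤ C * Real.exp (-a * ‖v‖ ^ 2))
    {x v : E3} (hx : x ∈ Ω) (hv : v ≠ 0) :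
    |incomingTransport Ω ν g x v| ≤ C * Real.exp (-a * ‖v‖ ^ 2) := by
  have h1 := hg _ _ (exitPoint_mem_incomingBoundary hΩ hx hv)
  have h2 : Real.exp (-ν v * exitTime Ω x v) ≤ 1 := Real.exp_le_one_iff.2 (by
    nlinarith [mul_nonneg (hν v) (exitTime_nonneg Ω x v)])
  rw [incomingTransport, abs_mul, Real.abs_exp]
  calc _ ≤ 1 * |g (exitPoint Ω x v) v| := by gcongr
    _ ≤ _ := by rwa [one_mul]

lemma exists_abs_incomingTransport_sub_le (hΩ : IsPositivelyCurvedDomain Ω)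
    (hB : IsCutoffCrossSection γ B) (ha : 0 < a) (hC : 0 < C)
    (hg : ∀ q v : E3, (q, v) ∈ incomingBoundary Ω → |g q v| ≤ C * Real.exp (-a * ‖v‖ ^ 2))
    (hg' : ∀ q₁ q₂ v : E3, (q₁, v) ∈ incomingBoundary Ω → (q₂, v) ∈ incomingBoundary Ω →
      |g q₁ v - g q₂ v| ≤ C * ‖q₁ - q₂‖) :
    ∃ K : ℝ, 0 ≤ K ∧ ∀ x ∈ Ω, ∀ y ∈ Ω, ∀ v ≠ 0,
      |incomingTransport Ω (collisionFrequency B) g x v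
        - incomingTransport Ω (collisionFrequency B) g y v| ≤ K * (1 + ‖v‖⁻¹) *
        (‖x - y‖ * ((√(Metric.infDist x Ωᶜ))⁻¹ + (√(Metric.infDist y Ωᶜ))⁻¹)) := by
  obtain ⟨R, hR, H⟩ := hΩ.exists_isEnclosedAt
  obtain ⟨N, hN, hνN⟩ := exists_collisionFrequency_le hB
  refine ⟨C * (N + 2) * √R, by positivity, fun x hx y hy v hv => ?_⟩
  set W := ‖x - y‖ * ((√(Metric.infDist x Ωᶜ))⁻¹ + (√(Metric.infDist y Ωᶜ))⁻¹) with hW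
  have hv' : 0 < ‖v‖ := norm_pos_iff.2 hv
  have hW0 : 0 ≤ W := by positivity
  set ν := collisionFrequency B v with hνdef
  have hν0 : 0 ≤ ν := collisionFrequency_nonneg hB v
  have hτ := abs_exitTime_sub_le hΩ hR H hx hy hv
  have hq := norm_exitPoint_sub_le hΩ hR H hx hy hv
  rw [mul_assoc, ← hW] at hτ hq
  set τx := exitTime Ω x v with hτx
  set τy := exitTime Ω y v with hτy
  have hx0 : 0 ≤ ν * τx := mul_nonneg hν0 (exitTime_nonneg _ _ _)
  have hy0 : 0 ≤ ν * τy := mul_nonneg hν0 (exitTime_nonneg _ _ _)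
  have hpx := exitPoint_mem_incomingBoundary hΩ hx hv
  have hpy := exitPoint_mem_incomingBoundary hΩ hy hv
  -- The Gaussian factor is dropped here; decay in `v` is recovered later from the `ε` power in the
  -- interpolation.
  have hgx : |g (exitPoint Ω x v) v| ≤ C := (hg _ _ hpx).trans (by
    have : Real.exp (-a * ‖v‖ ^ 2) ≤ 1 := Real.exp_le_one_iff.2 (by
      nlinarith [sq_nonneg ‖v‖, mul_nonneg ha.le (sq_nonneg ‖v‖)])
    nlinarith)
  have hgd := hg' _ _ v hpx hpy
  have hτ' : |τx - τy| ≤ √R * W / ‖v‖ := by rwa [le_div_iff₀ hv']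
  -- The `1 / ‖v‖` of the exit time bound meets the linear growth of the frequency, leaving `1 +
  -- ‖v‖⁻¹`.
  have hexp : |Real.exp (-(ν * τx)) - Real.exp (-(ν * τy))|
      ≤ N * (1 + ‖v‖⁻¹) * (√R * W) := by
    refine (abs_exp_neg_sub_exp_neg_le hx0 hy0).trans ?_
    rw [← mul_sub, abs_mul, abs_of_nonneg hν0]
    calc ν * |τx - τy| ≤ (N * (1 + ‖v‖)) * (√R * W / ‖v‖) := by
          gcongr
          exact hνN v
      _ = _ := by field_simp; ring
  have hy1 : Real.exp (-(ν * τy)) ≤ 1 := Real.exp_le_one_iff.2 (by linarith)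
  have hdecomp : incomingTransport Ω (collisionFrequency B) g x v
        - incomingTransport Ω (collisionFrequency B) g y v
      = (Real.exp (-(ν * τx)) - Real.exp (-(ν * τy))) * g (exitPoint Ω x v) v
        + Real.exp (-(ν * τy)) * (g (exitPoint Ω x v) v - g (exitPoint Ω y v) v) := by
    simp only [incomingTransport, neg_mul]
    ring
  rw [hdecomp]
  refine (abs_add_le _ _).trans ?_
  rw [abs_mul, abs_mul, Real.abs_exp]
  have h1 : |Real.exp (-(ν * τx)) - Real.exp (-(ν * τy))| * |g (exitPoint Ω x v) v|
      ≤ N * (1 + ‖v‖⁻¹) * (√R * W) * C := by gcongr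
  have h2 : Real.exp (-(ν * τy)) * |g (exitPoint Ω x v) v - g (exitPoint Ω y v) v|
      ≤ 1 * (C * (2 * (√R * W))) := by
    gcongr
    exact hgd.trans (by gcongr)
  have h3 : 0 ≤ C * (2 * (√R * W)) * ‖v‖⁻¹ := by positivity
  linarith

lemma memLp_two_incomingTransport (hΩ : IsPositivelyCurvedDomain Ω) {ν : E3 → ℝ}
    (hνm : Measurable ν) (hν : ∀ v, 0 ≤ ν v) (hg : IsAdmissibleIncomingData Ω g) :
    MemLp (Function.uncurry (incomingTransport Ω ν g)) 2
      ((volume.restrict Ω).prod volume) := by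
  obtain ⟨a, C, ha, hC, hgb, -⟩ := hg.bounds
  have hfin : IsFiniteMeasure (volume.restrict Ω) :=
    isFiniteMeasure_restrict.2 hΩ.isBounded.measure_lt_top.ne
  have hdom : MemLp (fun p : E3 × E3 => C * Real.exp (-a * ‖p.2‖ ^ 2)) 2
      ((volume.restrict Ω).prod volume) := by
    rw [memLp_two_iff_integrable_sq (by fun_prop)]
    have h0 := (integrable_norm_rpow_mul_exp_neg_mul_sq (b := 2 * a) (s := 0) (by positivity)
      (by norm_num)).const_mul (C ^ 2)
    refine (h0.comp_snd (volume.restrict Ω)).congr (Eventually.of_forall fun p => ?_)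
    simp only [Real.rpow_zero, one_mul]
    rw [mul_pow, ← Real.exp_nat_mul]
    push_cast
    ring_nf
  refine hdom.of_le (aemeasurable_incomingTransport hΩ hνm hg.measurable).aestronglyMeasurable ?_
  rw [restrict_prod_volume_eq]
  filter_upwards [ae_restrict_mem hΩ.measurableSet_prod] with p hp
  rw [Real.norm_eq_abs, Real.norm_of_nonneg (by positivity)]
  exact abs_incomingTransport_le hΩ hν hgb hp.1 hp.2

lemma lintegral_gaussian_mul_lt_top {b K : ℝ} (hb : 0 < b) :
    ∫⁻ v : E3, ENNReal.ofReal (K * Real.exp (-b * ‖v‖ ^ 2) * (1 + ‖v‖⁻¹) ^ 2) < ∞ := by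
  have h0 := integrable_norm_rpow_mul_exp_neg_mul_sq (s := 0) hb (by norm_num)
  have h1 := integrable_norm_rpow_mul_exp_neg_mul_sq (s := -1) hb (by norm_num)
  have h2 := integrable_norm_rpow_mul_exp_neg_mul_sq (s := -2) hb (by norm_num)
  have := ((h0.add (h1.const_mul 2)).add h2).const_mul K
  refine Integrable.lintegral_lt_top (this.congr (Eventually.of_forall fun v => ?_))
  simp only [Pi.add_apply, Real.rpow_zero, Real.rpow_neg_one,
    Real.rpow_neg (norm_nonneg v) 2, Real.rpow_two]
  ring

lemma lintegral_gagliardo_incomingTransport_lt_top (hΩ : IsPositivelyCurvedDomain Ω)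
    (hB : IsCutoffCrossSection γ B) (hg : IsAdmissibleIncomingData Ω g) {ε : ℝ} (hε : 0 < ε)
    (hε1 : ε < 1) :
    ∫⁻ v : E3, ∫⁻ y in Ω, ∫⁻ x in Ω, ENNReal.ofReal
      (|incomingTransport Ω (collisionFrequency B) g x v
        - incomingTransport Ω (collisionFrequency B) g y v| ^ 2
        / ‖x - y‖ ^ (3 + 2 * (1 - ε))) < ∞ := by
  obtain ⟨a, C, ha, hC, hgb, hgl⟩ := hg.bounds
  obtain ⟨K, hK, hlip⟩ := exists_abs_incomingTransport_sub_le hΩ hB ha hC hgb hgl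
  -- `p` is the power on the Lipschitz bound; `β = p / 2 < 1` is the resulting power of the inverse
  -- distance. The `4` in `M` comes from splitting the `p`-th power of a sum.
  set p := 2 - ε with hp
  set β := p / 2 with hβ
  set M := (2 * C) ^ ε * K ^ p * 4 with hM
  have hM0 : 0 ≤ M := by positivity
  set D : E3 → ℝ≥0∞ := fun x => ENNReal.ofReal ((Metric.infDist x Ωᶜ)⁻¹ ^ β)
  have hDm : Measurable D :=
    ((Metric.continuous_infDist_pt _).measurable.inv.pow_const _).ennreal_ofReal
  have hD : ∫⁻ x in Ω, D x < ∞ := lintegral_inv_infDist_rpow_lt_top hΩ.isOpen hΩ.isBounded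
    hΩ.convex (by rw [hβ, hp]; linarith) (by rw [hβ, hp]; linarith)
  have hI := lintegral_lintegral_weighted_lt_top hΩ.isOpen hΩ.isBounded hDm hD (α := 3 - ε)
    (by linarith)
  have hpt : ∀ v ≠ 0, ∀ y ∈ Ω, ∀ x ∈ Ω, ENNReal.ofReal
      (|incomingTransport Ω (collisionFrequency B) g x v
        - incomingTransport Ω (collisionFrequency B) g y v| ^ 2
        / ‖x - y‖ ^ (3 + 2 * (1 - ε)))
      ≤ ENNReal.ofReal (M * Real.exp (-(a * ε) * ‖v‖ ^ 2) * (1 + ‖v‖⁻¹) ^ 2)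
        * ((D x + D y) * ENNReal.ofReal (‖x - y‖ ^ (-(3 - ε)))) := by
    intro v hv y hy x hx
    rw [← ENNReal.ofReal_add (Real.rpow_nonneg (inv_nonneg.2 Metric.infDist_nonneg) _)
      (Real.rpow_nonneg (inv_nonneg.2 Metric.infDist_nonneg) _),
      ← ENNReal.ofReal_mul (add_nonneg (Real.rpow_nonneg (inv_nonneg.2 Metric.infDist_nonneg) _)
      (Real.rpow_nonneg (inv_nonneg.2 Metric.infDist_nonneg) _)),
      ← ENNReal.ofReal_mul (by positivity)]
    refine ENNReal.ofReal_le_ofReal ?_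
    set dx := Metric.infDist x Ωᶜ
    set dy := Metric.infDist y Ωᶜ
    have hdx : 0 ≤ dx⁻¹ := inv_nonneg.2 Metric.infDist_nonneg
    have hdy : 0 ≤ dy⁻¹ := inv_nonneg.2 Metric.infDist_nonneg
    rcases eq_or_ne x y with rfl | hxy
    · rw [sub_self, abs_zero, zero_pow two_ne_zero, zero_div]
      positivity
    have hr : 0 < ‖x - y‖ := norm_pos_iff.2 (sub_ne_zero.2 hxy)
    have hA : |incomingTransport Ω (collisionFrequency B) g x v
        - incomingTransport Ω (collisionFrequency B) g y v|
        ≤ 2 * C * Real.exp (-a * ‖v‖ ^ 2) := by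
      have h1 := abs_incomingTransport_le hΩ (collisionFrequency_nonneg hB) hgb hx hv
      have h2 := abs_incomingTransport_le hΩ (collisionFrequency_nonneg hB) hgb hy hv
      refine (abs_sub _ _).trans ?_
      linarith
    have hsq := sq_le_rpow_mul_rpow (abs_nonneg _) hA (hlip x hx y hy v hv) hε hε1
    have hsqrt : ∀ d : ℝ, 0 ≤ d⁻¹ → ((√d)⁻¹) ^ p = (d⁻¹) ^ β := fun d hd => by
      rw [← Real.sqrt_inv, Real.sqrt_eq_rpow, ← Real.rpow_mul hd, hβ]
      ring_nf
    have hp0 : 0 ≤ p := by rw [hp]; linarith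
    have hp2 : p ≤ 2 := by rw [hp]; linarith
    -- The base is at least `1`, so the exponent may be raised to `2`, still integrable at `v = 0`
    -- in dimension three.
    have hv1 : (1 + ‖v‖⁻¹) ^ p ≤ (1 + ‖v‖⁻¹) ^ 2 := by
      rw [← Real.rpow_two]
      exact Real.rpow_le_rpow_of_exponent_le
        (by linarith [inv_nonneg.2 (norm_nonneg v)]) hp2
    have hsum : ((√dx)⁻¹ + (√dy)⁻¹) ^ p ≤ 4 * (dx⁻¹ ^ β + dy⁻¹ ^ β) := by
      rw [← hsqrt dx hdx, ← hsqrt dy hdy]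
      exact add_rpow_le_four_mul (by positivity) (by positivity) hp0 hp2
    have hexp : (2 * C * Real.exp (-a * ‖v‖ ^ 2)) ^ ε
        = (2 * C) ^ ε * Real.exp (-(a * ε) * ‖v‖ ^ 2) := by
      rw [Real.mul_rpow (by positivity) (Real.exp_pos _).le, ← Real.exp_mul]
      ring_nf
    have hpow : ‖x - y‖ ^ p = ‖x - y‖ ^ (-(3 - ε)) * ‖x - y‖ ^ (3 + 2 * (1 - ε)) := by
      rw [← Real.rpow_add hr, hp]
      ring_nf
    rw [div_le_iff₀ (by positivity)]
    refine hsq.trans ?_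
    have hsplit : (K * (1 + ‖v‖⁻¹) * (‖x - y‖ * ((√dx)⁻¹ + (√dy)⁻¹))) ^ p
        = K ^ p * (1 + ‖v‖⁻¹) ^ p * (‖x - y‖ ^ p * ((√dx)⁻¹ + (√dy)⁻¹) ^ p) := by
      rw [Real.mul_rpow (by positivity) (by positivity), Real.mul_rpow hK (by positivity),
        Real.mul_rpow hr.le (by positivity)]
    rw [hexp, ← hp, hsplit, hpow]
    calc _ ≤ (2 * C) ^ ε * Real.exp (-(a * ε) * ‖v‖ ^ 2) * (K ^ p * (1 + ‖v‖⁻¹) ^ 2 *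
          (‖x - y‖ ^ (-(3 - ε)) * ‖x - y‖ ^ (3 + 2 * (1 - ε)) *
            (4 * (dx⁻¹ ^ β + dy⁻¹ ^ β)))) := by gcongr
      _ = _ := by rw [hM]; ring
  -- The majorant is a function of `v` times a function of `(x, y)`, so the triple integral factors.
  refine (lintegral_mono_ae (g := fun v =>
    ENNReal.ofReal (M * Real.exp (-(a * ε) * ‖v‖ ^ 2) * (1 + ‖v‖⁻¹) ^ 2)
      * ∫⁻ y in Ω, ∫⁻ x in Ω, (D x + D y) * ENNReal.ofReal (‖x - y‖ ^ (-(3 - ε)))) ?_).trans_lt ?_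
  · filter_upwards [compl_mem_ae_iff.2 (measure_singleton (0 : E3))] with v hv
    rw [← lintegral_const_mul' _ _ ENNReal.ofReal_ne_top]
    refine setLIntegral_mono' hΩ.isOpen.measurableSet fun y hy => ?_
    rw [← lintegral_const_mul' _ _ ENNReal.ofReal_ne_top]
    exact setLIntegral_mono' hΩ.isOpen.measurableSet fun x hx => hpt v hv y hy x hx
  · rw [lintegral_mul_const' _ _ hI.ne]
    exact ENNReal.mul_lt_top (lintegral_gaussian_mul_lt_top (by positivity)) hI

end Transport

end Boltzmann

end

theorem mainTheorem6 (Ω : Set Boltzmann.E3) (hΩ : Boltzmann.IsPositivelyCurvedDomain Ω)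
    (γ : ℝ) (B : ℝ → ℝ → ℝ) (hB : Boltzmann.IsCutoffCrossSection γ B)
    (g : Boltzmann.E3 → Boltzmann.E3 → ℝ) (hg : Boltzmann.IsAdmissibleIncomingData Ω g)
    (ε : ℝ) (hε : 0 < ε) (hε1 : ε < 1) :
    Boltzmann.MemL2Hs (1 - ε) Ω
      (Boltzmann.incomingTransport Ω (Boltzmann.collisionFrequency B) g) := by
  exact ⟨Boltzmann.memLp_two_incomingTransport hΩ
      (Boltzmann.measurable_collisionFrequency hB.measurable)
      (Boltzmann.collisionFrequency_nonneg hB) hg,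
    Boltzmann.lintegral_gagliardo_incomingTransport_lt_top hΩ hB hg hε hε1⟩
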